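/- Consider Burgers' equation $\partial_t u + u\,\partial_x u = \partial_x^2 u$ on $\mathbb{R}$. For $u_0\in L^\infty(\mathbb{R})$ let $u(t,\cdot)=\mathcal{S}_t(u_0)$, $t>0$, denote its unique solution in $C^0((0,\infty),L^\infty(\mathbb{R}))$, classical for $t>0$, such that $u(t,\cdot)\to u_0$ in the weak-$*$ topology of $L^\infty(\mathbb{R})$ as $t\to0+$, and let $$\omega_0(u_0)=\bigl\{v\in L^\infty(\mathbb{R})\,\big|\,\exists\,t_k\to\infty\text{ such that }\mathcal{S}_{t_k}(u_0)\to v\text{ uniformly on }[-R,R]\text{ for every }R>0\bigr\}.$$ For $\alpha\le\beta$ let $\phi_{\beta,\alpha}(y)=\frac{\alpha+\beta}{2}-\frac{\beta-\alpha}{2}\tanh\bigl(\frac{\beta-\alpha}{4}y\bigr)$ be the viscous shock profile (a constant if $\alpha=\beta$), let $\Sigma=\{\phi_{\beta,\alpha}(\cdot-y)\,;\,\alpha\le\beta,\ y\in\mathbb{R}\}$, and for $\gamma>0$ let $\Psi_\gamma(x)=\dfrac{-2\sinh x}{\gamma+\cosh x}$. **Proposition.** There exists $u_0\in L^\infty(\mathbb{R})$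 such that $$\omega_0(u_0)\supset\{\Psi_\gamma\,;\,\gamma>0\}\cup\{\phi_{\delta,-\delta}\,;\,\delta\in[0,2]\}.$$ In particular $\omega_0(u_0)\not\subset\Sigma$. In fact $v(t,x)=\dfrac{-2\sinh x}{e^{-t}+\cosh x}$ is a classical solution of Burgers' equation on $\mathbb{R}\times\mathbb{R}$ such that, for all $t\in\mathbb{R}$, $v(t,\cdot)\in\omega_0(u_0)$ and $v(t,\cdot)\notin\Sigma$ (it is neither a constant nor a shock), and it describes the merger of a pair of shocks into a single shock: uniformly in $x\in\mathbb{R}$, $$v(t,x)-\bigl(\phi_{2,0}(x-t+\log2)+\phi_{0,-2}(x+t-\log2)\bigr)\to0\ \text{ as }t\to-\infty,\qquad v(t,x)\to\phi_{2,-2}(x)\ \text{ as }t\to+\infty.$$ -/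

import Mathlib

open Set Filter Topology MeasureTheory

namespace Burgers

/-- `u` is a classical (`C¹` in time, `C²` in space) solution of the viscous Burgers equation
`∂ₜu + u ∂ₓu = ∂ₓ²u` for all times `t` in the open set `I` and all `x ∈ ℝ`. -/
structure IsClassicalSolution (I : Set ℝ) (u : ℝ → ℝ → ℝ) : Prop where
  continuousOn : ContinuousOn (fun p : ℝ × ℝ => u p.1 p.2) (I ×ˢ univ)
  differentiableAt_time : ∀ t ∈ I, ∀ x : ℝ, DifferentiableAt ℝ (fun s => u s x) t
  contDiff_space : ∀ t ∈ I, ContDiff ℝ 2 (u t)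
  continuousOn_dt : ContinuousOn (fun p : ℝ × ℝ => deriv (fun s => u s p.2) p.1) (I ×ˢ univ)
  continuousOn_dx : ContinuousOn (fun p : ℝ × ℝ => deriv (u p.1) p.2) (I ×ˢ univ)
  continuousOn_dxx : ContinuousOn (fun p : ℝ × ℝ => iteratedDeriv 2 (u p.1) p.2) (I ×ˢ univ)
  equation : ∀ t ∈ I, ∀ x : ℝ,
    deriv (fun s => u s x) t + u t x * deriv (u t) x = iteratedDeriv 2 (u t) x

/-- `u` is the solution of the Cauchy problem for Burgers' equation with initial data
`u₀ ∈ L^∞(ℝ)`: a classical solution for positive times that belongs to `C⁰((0,∞), L^∞(ℝ))` and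
converges to `u₀` in the weak-* topology of `L^∞(ℝ)` as `t → 0+`. The Cauchy problem is globally
well-posed in `L^∞(ℝ)`, so for each `u₀` exactly one such `u` exists (up to its irrelevant
values at `t ≤ 0`), and `u t = S_t(u₀)` for `t > 0`. -/
structure IsCauchySolution (u₀ : ℝ → ℝ) (u : ℝ → ℝ → ℝ) : Prop where
  classical : IsClassicalSolution (Ioi 0) u
  bounded : ∀ t : ℝ, 0 < t → ∃ C : ℝ, ∀ x : ℝ, |u t x| ≤ C
  continuous_sup : ∀ t : ℝ, 0 < t → TendstoUniformly u (u t) (𝓝 t)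
  weakStar : ∀ g : ℝ → ℝ, Integrable g →
    Tendsto (fun t => ∫ x, u t x * g x) (𝓝[>] (0 : ℝ)) (𝓝 (∫ x, u₀ x * g x))

/-- The `ω`-limit set `ω₀(u₀)`: all `v ∈ L^∞(ℝ)` such that `S_{t_k}(u₀) → v` uniformly on every
interval `[-R, R]`, for some sequence `t_k → ∞`. Elements are represented by functions. -/
def omegaZero (u₀ : ℝ → ℝ) : Set (ℝ → ℝ) :=
  {v | MemLp v ⊤ volume ∧ ∃ u : ℝ → ℝ → ℝ, IsCauchySolution u₀ u ∧
    ∃ t : ℕ → ℝ, Tendsto t atTop atTop ∧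
      ∀ R : ℝ, TendstoUniformlyOn (fun k => u (t k)) v atTop (Icc (-R) R)}

/-- The viscous shock profile `φ_{β,α}`, a constant if `α = β`. -/
noncomputable def shock (β α : ℝ) (y : ℝ) : ℝ :=
  (α + β) / 2 - (β - α) / 2 * Real.tanh ((β - α) / 2 * y / 2)

/-- The set `Σ` of all translates of all viscous shocks, including the constants. -/
def shocksAndConstants : Set (ℝ → ℝ) :=
  {v | ∃ β α y : ℝ, α ≤ β ∧ v = fun x => shock β α (x - y)}

/-- The functions `Ψ_γ`. -/
noncomputable def psi (γ : ℝ) (x : ℝ) : ℝ :=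
  -2 * Real.sinh x / (γ + Real.cosh x)

/-- The two-shock solution of Burgers' equation. -/
noncomputable def twoShock (t x : ℝ) : ℝ :=
  -2 * Real.sinh x / (Real.exp (-t) + Real.cosh x)

end Burgers

namespace Burgers


/-! By Hopf–Cole, `-2 ∂ₓ log W` solves Burgers' equation whenever `W` is a positive solution of the
heat equation. The weight `γ exp (k² s) + cosh (k y)` evolves by time `s` into `exp (k² s) (γ + cosh
(k x))`, up to normalization, so at that time the solution equals `profile (γ, k)`. These profiles
contain every `Ψ_γ` (`k = 1`) and every symmetric shock (`γ = 0`, `k = δ / 2`).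

The point is that a late time sees the weight only on a distant annulus
(`exists_hopfCole_sub_profile_le`). The part of the weight inside radius `r` contributes a bounded
multiple of its value at `r`, while the whole heat integral is at least `√s` times that value.
Beyond a radius proportional to `s`, the Gaussian beats the exponential growth. Hence one weight can
be built on successive annuli, each tuned to its own profile and its own time
(`exists_hopfCole_shadowing`). The pieces are glued through increments of their logarithms: this
preserves the Lipschitz bound on the logarithm, and it changes each piece only by a constant factor,
which Hopf–Cole ignores.

Letting the parameters run through a dense sequence, each term repeated infinitely often, puts every
profile with `γ ≥ 0` and `0 ≤ k ≤ 1` into a single `ω`-limit set (`exists_profile_mem_omegaZero`).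
The two-shock solution at time `t` is `Ψ_γ` with `γ = exp (-t)`; its asymptotics come from the
Lipschitz dependence of `Ψ_γ` on `γ`. -/

/-- A criterion for classical solutions in terms of candidate partial derivatives. -/
lemma IsClassicalSolution.of_hasDerivAt {I : Set ℝ} {u ut ux uxx : ℝ → ℝ → ℝ}
    (ht : ∀ t ∈ I, ∀ x, HasDerivAt (fun s => u s x) (ut t x) t)
    (hx : ∀ t ∈ I, ∀ x, HasDerivAt (u t) (ux t x) x)
    (hxx : ∀ t ∈ I, ∀ x, HasDerivAt (ux t) (uxx t x) x)
    (cu : ContinuousOn (fun p : ℝ × ℝ => u p.1 p.2) (I ×ˢ univ))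
    (cut : ContinuousOn (fun p : ℝ × ℝ => ut p.1 p.2) (I ×ˢ univ))
    (cux : ContinuousOn (fun p : ℝ × ℝ => ux p.1 p.2) (I ×ˢ univ))
    (cuxx : ContinuousOn (fun p : ℝ × ℝ => uxx p.1 p.2) (I ×ˢ univ))
    (heq : ∀ t ∈ I, ∀ x, ut t x + u t x * ux t x = uxx t x) :
    IsClassicalSolution I u := by
  have dx : ∀ t ∈ I, deriv (u t) = ux t := fun t h => funext fun x => (hx t h x).deriv
  have dxx : ∀ t ∈ I, iteratedDeriv 2 (u t) = uxx t := fun t h => by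
    rw [iteratedDeriv_succ, iteratedDeriv_one, dx t h]
    exact funext fun x => (hxx t h x).deriv
  have cxx : ∀ t ∈ I, Continuous (uxx t) := fun t h => by
    have := cuxx.comp_continuous (f := fun x : ℝ => (t, x)) (by fun_prop) (fun x => ⟨h, trivial⟩)
    exact this
  refine ⟨cu, fun t h x => (ht t h x).differentiableAt, fun t h => ?_, ?_, ?_, ?_, ?_⟩
  · have h1 : ContDiff ℝ 1 (ux t) := by
      rw [contDiff_one_iff_deriv]
      refine ⟨fun x => (hxx t h x).differentiableAt, ?_⟩
      rw [funext fun x => (hxx t h x).deriv]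
      exact cxx t h
    rw [show (2 : WithTop ℕ∞) = 1 + 1 by norm_num, contDiff_succ_iff_deriv]
    refine ⟨fun x => (hx t h x).differentiableAt, by simp, ?_⟩
    rw [dx t h]
    exact h1
  · exact cut.congr fun p hp => (ht p.1 hp.1 p.2).deriv
  · exact cux.congr fun p hp => (hx p.1 hp.1 p.2).deriv
  · exact cuxx.congr fun p hp => congrFun (dxx p.1 hp.1) p.2
  · intro t h x
    rw [(ht t h x).deriv, (hx t h x).deriv, dxx t h]
    exact heq t h x

/-! ### Log-Lipschitz weights and their Gaussian moments. -/

/-- Positive functions whose logarithm is `1`-Lipschitz. -/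
structure LogLipschitz (w : ℝ → ℝ) : Prop where
  pos : ∀ y, 0 < w y
  le : ∀ x y, w y ≤ Real.exp |y - x| * w x

lemma LogLipschitz.continuous {w : ℝ → ℝ} (hw : LogLipschitz w) : Continuous w := by
  have h : LipschitzWith 1 (fun y => Real.log (w y)) := by
    refine LipschitzWith.of_le_add fun x y => ?_
    have := Real.log_le_log (hw.pos x) (hw.le y x)
    rw [Real.log_mul (Real.exp_pos _).ne' (hw.pos y).ne', Real.log_exp] at this
    rw [Real.dist_eq]
    linarith
  have h2 := Real.continuous_exp.comp h.continuous
  refine h2.congr fun y => ?_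
  simp [Real.exp_log (hw.pos y)]

/-- The moments of a weight with respect to the (unnormalized) heat kernel. -/
noncomputable def heatMoment (w : ℝ → ℝ) (j : ℕ) (s x : ℝ) : ℝ :=
  ∫ y, (y - x) ^ j * Real.exp (-(y - x) ^ 2 / (4 * s)) * w y

/-- The majorant used in all dominated convergence arguments. -/
noncomputable def gaussBound (j : ℕ) (S v : ℝ) : ℝ :=
  (|v| + 1) ^ j * Real.exp (1 / (4 * S) + |v| - 1 / (8 * S) * v ^ 2)

lemma gaussBound_continuous (j : ℕ) (S : ℝ) : Continuous (gaussBound j S) := by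
  unfold gaussBound; fun_prop

lemma gaussBound_integrable (j : ℕ) {S : ℝ} (hS : 0 < S) : Integrable (gaussBound j S) := by
  set b : ℝ := 1 / (8 * S) with hb
  have hb0 : 0 < b := by positivity
  have hi : Integrable fun v : ℝ =>
      (j.factorial * Real.exp (1 + 1 / (4 * S) + 2 / b)) * Real.exp (-(b / 2) * v ^ 2) :=
    (integrable_exp_neg_mul_sq (by positivity)).const_mul _
  refine hi.mono' (gaussBound_continuous j S).aestronglyMeasurable (ae_of_all _ fun v => ?_)
  have h0 : (|v| + 1) ^ j ≤ j.factorial * Real.exp (|v| + 1) := by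
    have := Real.pow_div_factorial_le_exp (|v| + 1) (by positivity) j
    rwa [div_le_iff₀ (by positivity), mul_comm] at this
  have h1 : 2 * |v| ≤ 2 / b + b / 2 * v ^ 2 := by
    have e : 2 / b + b / 2 * v ^ 2 - 2 * |v| = (b * |v| - 2) ^ 2 / (2 * b) := by
      rw [← sq_abs v]; field_simp; ring
    have : 0 ≤ (b * |v| - 2) ^ 2 / (2 * b) := by positivity
    linarith
  rw [Real.norm_of_nonneg (by unfold gaussBound; positivity)]
  calc gaussBound j S v
      ≤ j.factorial * Real.exp (|v| + 1) * Real.exp (1 / (4 * S) + |v| - b * v ^ 2) := by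
        unfold gaussBound; gcongr
    _ = j.factorial * Real.exp (|v| + 1 + (1 / (4 * S) + |v| - b * v ^ 2)) := by
        rw [mul_assoc, ← Real.exp_add]
    _ ≤ j.factorial * Real.exp (1 + 1 / (4 * S) + 2 / b + -(b / 2) * v ^ 2) := by
        refine mul_le_mul_of_nonneg_left (Real.exp_le_exp.2 ?_) (by positivity)
        linarith
    _ = _ := by rw [Real.exp_add _ (-(b / 2) * v ^ 2), mul_assoc]

section Moments

variable {w : ℝ → ℝ}

/-- The weight enters the bound only through the factor `w x₀`. This serves dominated convergence,
and it also makes quotients of moments bounded uniformly in space although `w` may grow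
exponentially. -/
lemma heatMoment_integrand_le (hw : LogLipschitz w) (j : ℕ) {s S x x₀ : ℝ} (hs : 0 < s)
    (hsS : s ≤ S) (hx : |x - x₀| ≤ 1) (y : ℝ) :
    |(y - x) ^ j * Real.exp (-(y - x) ^ 2 / (4 * s)) * w y| ≤
      w x₀ * gaussBound j S (y - x₀) := by
  have hS : 0 < S := hs.trans_le hsS
  set v := y - x₀ with hv
  have e : y - x = v - (x - x₀) := by rw [hv]; ring
  have h1 : |y - x| ≤ |v| + 1 := by
    rw [e]; exact (abs_sub _ _).trans (by linarith)
  have h2 : v ^ 2 / 2 - 1 ≤ (y - x) ^ 2 := by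
    have : (x - x₀) ^ 2 ≤ 1 := by rw [← sq_abs]; nlinarith [abs_nonneg (x - x₀)]
    rw [e]
    nlinarith [sq_nonneg (v - 2 * (x - x₀))]
  have h3 : -(y - x) ^ 2 / (4 * s) ≤ 1 / (4 * S) - 1 / (8 * S) * v ^ 2 := by
    have a1 : (y - x) ^ 2 / (4 * S) ≤ (y - x) ^ 2 / (4 * s) := by gcongr
    have a2 : (v ^ 2 / 2 - 1) / (4 * S) ≤ (y - x) ^ 2 / (4 * S) := by gcongr
    have a3 : (v ^ 2 / 2 - 1) / (4 * S) = 1 / (8 * S) * v ^ 2 - 1 / (4 * S) := by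
      field_simp; ring
    rw [neg_div]; linarith
  rw [abs_mul, abs_mul, abs_pow, Real.abs_exp, abs_of_pos (hw.pos y)]
  calc |y - x| ^ j * Real.exp (-(y - x) ^ 2 / (4 * s)) * w y
      ≤ (|v| + 1) ^ j * Real.exp (1 / (4 * S) - 1 / (8 * S) * v ^ 2) *
        (Real.exp |v| * w x₀) := by
        gcongr
        · exact (hw.pos y).le
        · exact hw.le x₀ y
    _ = w x₀ * gaussBound j S v := by
        unfold gaussBound
        rw [show 1 / (4 * S) + |v| - 1 / (8 * S) * v ^ 2 =
          (1 / (4 * S) - 1 / (8 * S) * v ^ 2) + |v| by ring, Real.exp_add]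
        ring

lemma heatMoment_integrand_continuous (hw : LogLipschitz w) (j : ℕ) (s x : ℝ) :
    Continuous fun y => (y - x) ^ j * Real.exp (-(y - x) ^ 2 / (4 * s)) * w y := by
  have := hw.continuous
  fun_prop

lemma heatMoment_bound_integrable (j : ℕ) {S : ℝ} (hS : 0 < S) (x₀ c : ℝ) :
    Integrable fun y => c * gaussBound j S (y - x₀) :=
  ((gaussBound_integrable j hS).comp_sub_right x₀).const_mul c

lemma heatMoment_integrable (hw : LogLipschitz w) (j : ℕ) {s : ℝ} (hs : 0 < s) (x : ℝ) :
    Integrable fun y => (y - x) ^ j * Real.exp (-(y - x) ^ 2 / (4 * s)) * w y :=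
  (heatMoment_bound_integrable j hs x (w x)).mono'
    (heatMoment_integrand_continuous hw j s x).aestronglyMeasurable
    (ae_of_all _ fun y => heatMoment_integrand_le hw j hs le_rfl (by simp) y)

lemma heatMoment_continuousAt (hw : LogLipschitz w) (j : ℕ) {s : ℝ} (hs : 0 < s) (x : ℝ) :
    ContinuousAt (fun p : ℝ × ℝ => heatMoment w j p.1 p.2) (s, x) := by
  have hnhds : ∀ᶠ p : ℝ × ℝ in 𝓝 (s, x), (0 < p.1 ∧ p.1 ≤ 2 * s) ∧ |p.2 - x| ≤ 1 := by
    have h1 : ∀ᶠ p : ℝ × ℝ in 𝓝 (s, x), p.1 ∈ Ioo 0 (2 * s) :=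
      continuousAt_fst.eventually (Ioo_mem_nhds hs (by linarith))
    have h2 : ∀ᶠ p : ℝ × ℝ in 𝓝 (s, x), p.2 ∈ Metric.ball x 1 :=
      continuousAt_snd.eventually (Metric.ball_mem_nhds x one_pos)
    filter_upwards [h1, h2] with p h1 h2
    exact ⟨⟨h1.1, h1.2.le⟩, by simpa [Real.dist_eq] using (Metric.mem_ball.1 h2).le⟩
  refine continuousAt_of_dominated (bound := fun y => w x * gaussBound j (2 * s) (y - x))
    (Eventually.of_forall fun p =>
      (heatMoment_integrand_continuous hw j p.1 p.2).aestronglyMeasurable) ?_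
    (heatMoment_bound_integrable j (by positivity) x (w x)) (ae_of_all _ fun y => ?_)
  · filter_upwards [hnhds] with p hp
    exact ae_of_all _ fun y => heatMoment_integrand_le hw j hp.1.1 hp.1.2 hp.2 y
  · have : (4 * s) ≠ 0 := by positivity
    have h1 : ContinuousAt (fun p : ℝ × ℝ => -(y - p.2) ^ 2 / (4 * p.1)) (s, x) :=
      ContinuousAt.div (by fun_prop) (by fun_prop) this
    have h2 : ContinuousAt (fun p : ℝ × ℝ => (y - p.2) ^ j) (s, x) := by fun_prop
    exact (h2.mul h1.rexp).mul continuousAt_const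

lemma heatMoment_hasDerivAt_space (hw : LogLipschitz w) (j : ℕ) {s : ℝ} (hs : 0 < s) (x : ℝ) :
    HasDerivAt (heatMoment w j s)
      (-(j * heatMoment w (j - 1) s x) + heatMoment w (j + 1) s x / (2 * s)) x := by
  have key := hasDerivAt_integral_of_dominated_loc_of_deriv_le (μ := volume) (𝕜 := ℝ)
    (F := fun x y => (y - x) ^ j * Real.exp (-(y - x) ^ 2 / (4 * s)) * w y)
    (F' := fun x y =>
      -- For `j = 0` the truncated exponent `j - 1` is harmless, since the factor `j` kills the
      -- term.
      -(j * ((y - x) ^ (j - 1) * Real.exp (-(y - x) ^ 2 / (4 * s)) * w y)) +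
        (y - x) ^ (j + 1) * Real.exp (-(y - x) ^ 2 / (4 * s)) * w y / (2 * s))
    (x₀ := x) (s := Metric.ball x 1)
    (bound := fun y => j * (w x * gaussBound (j - 1) s (y - x)) +
      w x * gaussBound (j + 1) s (y - x) / (2 * s))
    (Metric.ball_mem_nhds x one_pos)
    (Eventually.of_forall fun x =>
      (heatMoment_integrand_continuous hw j s x).aestronglyMeasurable)
    (heatMoment_integrable hw j hs x) ?_ (ae_of_all _ fun y z hz => ?_)
    (((heatMoment_bound_integrable (j - 1) hs x (w x)).const_mul _).add
      ((heatMoment_bound_integrable (j + 1) hs x (w x)).div_const _))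
    (ae_of_all _ fun y z hz => ?_)
  · have h := key.2
    rw [integral_add, integral_neg, integral_const_mul, integral_div] at h
    · exact h
    · exact ((heatMoment_integrable hw (j - 1) hs x).const_mul _).neg
    · exact (heatMoment_integrable hw (j + 1) hs x).div_const _
  · exact (((heatMoment_integrand_continuous hw (j - 1) s x).const_mul _).neg.add
      ((heatMoment_integrand_continuous hw (j + 1) s x).div_const _)).aestronglyMeasurable
  · have hz' : |z - x| ≤ 1 := by simpa [Real.dist_eq] using (Metric.mem_ball.1 hz).le
    have h1 := heatMoment_integrand_le hw (j - 1) hs le_rfl hz' y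
    have h2 := heatMoment_integrand_le hw (j + 1) hs le_rfl hz' y
    rw [Real.norm_eq_abs]
    refine (abs_add_le _ _).trans ?_
    rw [abs_neg, abs_mul, abs_div, Nat.abs_cast, abs_of_pos (show 0 < 2 * s by positivity)]
    gcongr
  · have h1 : HasDerivAt (fun z => y - z) (-1) z := by
      simpa using (hasDerivAt_id z).const_sub y
    have h2 := h1.pow j
    have h3 : HasDerivAt (fun z => -(y - z) ^ 2 / (4 * s)) ((y - z) / (2 * s)) z := by
      have := (((h1.pow 2).neg).div_const (4 * s))
      refine this.congr_deriv ?_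
      field_simp
      norm_num
      ring
    have h4 := (h2.mul h3.exp).mul_const (w y)
    refine h4.congr_deriv ?_
    field_simp
    simp
    ring

lemma heatMoment_hasDerivAt_time (hw : LogLipschitz w) (j : ℕ) {s : ℝ} (hs : 0 < s) (x : ℝ) :
    HasDerivAt (fun s => heatMoment w j s x) (heatMoment w (j + 2) s x / (4 * s ^ 2)) s := by
  have key := hasDerivAt_integral_of_dominated_loc_of_deriv_le (μ := volume) (𝕜 := ℝ)
    (F := fun s y => (y - x) ^ j * Real.exp (-(y - x) ^ 2 / (4 * s)) * w y)
    (F' := fun s y => (y - x) ^ (j + 2) * Real.exp (-(y - x) ^ 2 / (4 * s)) * w y / (4 * s ^ 2))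
    (x₀ := s) (s := Ioo (s / 2) (2 * s))
    (bound := fun y => w x * gaussBound (j + 2) (2 * s) (y - x) / (4 * (s / 2) ^ 2))
    (Ioo_mem_nhds (by linarith) (by linarith))
    (Eventually.of_forall fun s =>
      (heatMoment_integrand_continuous hw j s x).aestronglyMeasurable)
    (heatMoment_integrable hw j hs x)
    ((heatMoment_integrand_continuous hw (j + 2) s x).div_const _).aestronglyMeasurable
    (ae_of_all _ fun y z hz => ?_)
    ((heatMoment_bound_integrable (j + 2) (by positivity) x (w x)).div_const _)
    (ae_of_all _ fun y z hz => ?_)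
  · have h := key.2
    rwa [integral_div] at h
  · have hz0 : 0 < z := by linarith [hz.1]
    have h2 := heatMoment_integrand_le hw (j + 2) hz0 hz.2.le (x := x) (x₀ := x) (by simp) y
    rw [Real.norm_eq_abs, abs_div, abs_of_pos (show 0 < 4 * z ^ 2 by positivity)]
    have := hz.1.le
    gcongr
    exact (abs_nonneg _).trans h2
  · have hz0 : 0 < z := by linarith [hz.1]
    have h3 : HasDerivAt (fun z => -(y - x) ^ 2 / (4 * z)) ((y - x) ^ 2 / (4 * z ^ 2)) z := by
      have := (hasDerivAt_inv hz0.ne').const_mul (-(y - x) ^ 2 / 4)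
      refine (this.congr_deriv ?_).congr_of_eventuallyEq (Eventually.of_forall fun z => ?_)
      · field_simp
      · simp only [div_eq_mul_inv, mul_inv]; ring
    have h4 := ((h3.exp).const_mul ((y - x) ^ j)).mul_const (w y)
    refine h4.congr_deriv ?_
    rw [pow_add]
    ring

/-- This is the lower counterpart of `heatMoment_integrand_le`: for `s ≥ 1` the Gaussian is at least
the one at `s = 1`, and `w y ≥ exp (-|y - x|) w x`. The factors `w x` cancel in the normalized
moments. -/
lemma heatMoment_zero_pos_le (hw : LogLipschitz w) :
    ∃ c : ℝ, 0 < c ∧ ∀ s x : ℝ, 1 ≤ s → c * w x ≤ heatMoment w 0 s x := by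
  have hint : Integrable fun v : ℝ => Real.exp (-v ^ 2 / 4 - |v|) := by
    refine (integrable_exp_neg_mul_sq (b := 1 / 4) (by norm_num)).mono'
      (by fun_prop) (ae_of_all _ fun v => ?_)
    rw [Real.norm_of_nonneg (Real.exp_pos _).le]
    exact Real.exp_le_exp.2 (by nlinarith [abs_nonneg v])
  refine ⟨∫ v : ℝ, Real.exp (-v ^ 2 / 4 - |v|), integral_exp_pos hint, fun s x hs => ?_⟩
  have hs0 : 0 < s := by linarith
  rw [← integral_sub_right_eq_self _ x, ← integral_mul_const]
  refine integral_mono ((hint.comp_sub_right x).mul_const _) (heatMoment_integrable hw 0 hs0 x)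
    fun y => ?_
  have h1 : Real.exp (-|y - x|) * w x ≤ w y := by
    have := hw.le y x
    rw [abs_sub_comm] at this
    rw [Real.exp_neg, inv_mul_le_iff₀ (Real.exp_pos _)]
    exact this
  have h2 : -(y - x) ^ 2 / 4 ≤ -(y - x) ^ 2 / (4 * s) := by
    rw [neg_div, neg_div, neg_le_neg_iff]
    gcongr
    linarith
  calc Real.exp (-(y - x) ^ 2 / 4 - |y - x|) * w x
      = Real.exp (-(y - x) ^ 2 / 4) * (Real.exp (-|y - x|) * w x) := by
        rw [sub_eq_add_neg, Real.exp_add]; ring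
    _ ≤ Real.exp (-(y - x) ^ 2 / (4 * s)) * w y := by
        gcongr
        have := hw.pos x
        positivity
    _ = _ := by simp

lemma heatMoment_zero_pos (hw : LogLipschitz w) {s : ℝ} (hs : 0 < s) (x : ℝ) :
    0 < heatMoment w 0 s x := by
  refine (integral_pos_iff_support_of_nonneg (fun y => ?_) (heatMoment_integrable hw 0 hs x)).2 ?_
  · have := hw.pos y
    positivity
  · have : (Function.support fun y => (y - x) ^ 0 * Real.exp (-(y - x) ^ 2 / (4 * s)) * w y)
        = univ := by
      ext y
      have := (hw.pos y).ne'
      simp [this]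
    rw [this]
    simp

/-! ### Normalized moments and the Hopf–Cole solution. -/

/-- The normalized moments. -/
noncomputable def normMoment (w : ℝ → ℝ) (j : ℕ) (s x : ℝ) : ℝ :=
  heatMoment w j s x / heatMoment w 0 s x

lemma normMoment_zero (hw : LogLipschitz w) {s : ℝ} (hs : 0 < s) (x : ℝ) :
    normMoment w 0 s x = 1 := div_self (heatMoment_zero_pos hw hs x).ne'

lemma normMoment_continuousAt (hw : LogLipschitz w) (j : ℕ) {s : ℝ} (hs : 0 < s) (x : ℝ) :
    ContinuousAt (fun p : ℝ × ℝ => normMoment w j p.1 p.2) (s, x) :=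
  (heatMoment_continuousAt hw j hs x).div (heatMoment_continuousAt hw 0 hs x)
    (heatMoment_zero_pos hw hs x).ne'

lemma normMoment_continuousOn (hw : LogLipschitz w) (j : ℕ) :
    ContinuousOn (fun p : ℝ × ℝ => normMoment w j p.1 p.2) (Ioi 0 ×ˢ univ) :=
  fun p hp => (normMoment_continuousAt hw j hp.1 p.2).continuousWithinAt

lemma normMoment_hasDerivAt_space (hw : LogLipschitz w) (j : ℕ) {s : ℝ} (hs : 0 < s) (x : ℝ) :
    HasDerivAt (normMoment w j s)
      (-(j * normMoment w (j - 1) s x) +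
        (normMoment w (j + 1) s x - normMoment w j s x * normMoment w 1 s x) / (2 * s)) x := by
  have h0 := (heatMoment_zero_pos hw hs x).ne'
  refine ((heatMoment_hasDerivAt_space hw j hs x).div
    (heatMoment_hasDerivAt_space hw 0 hs x) h0).congr_deriv ?_
  unfold normMoment
  simp only [Nat.cast_zero, zero_mul, neg_zero, zero_add]
  field_simp
  ring

lemma normMoment_hasDerivAt_time (hw : LogLipschitz w) (j : ℕ) {s : ℝ} (hs : 0 < s) (x : ℝ) :
    HasDerivAt (fun s => normMoment w j s x)
      ((normMoment w (j + 2) s x - normMoment w j s x * normMoment w 2 s x) / (4 * s ^ 2)) s := by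
  have h0 := (heatMoment_zero_pos hw hs x).ne'
  refine ((heatMoment_hasDerivAt_time hw j hs x).div
    (heatMoment_hasDerivAt_time hw 0 hs x) h0).congr_deriv ?_
  unfold normMoment
  field_simp

lemma normMoment_bounded (hw : LogLipschitz w) (j : ℕ) {S : ℝ} (hS : 0 < S) :
    ∃ K : ℝ, 0 ≤ K ∧ ∀ s x : ℝ, 1 ≤ s → s ≤ S → |normMoment w j s x| ≤ K := by
  obtain ⟨c, hc, h⟩ := heatMoment_zero_pos_le hw
  have hI : 0 ≤ ∫ v, gaussBound j S v :=
    integral_nonneg fun v => by unfold gaussBound; positivity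
  refine ⟨(∫ v, gaussBound j S v) / c, by positivity, fun s x h1 h2 => ?_⟩
  have hs : 0 < s := by linarith
  have hN : |heatMoment w j s x| ≤ w x * ∫ v, gaussBound j S v := by
    rw [← integral_sub_right_eq_self _ x, ← integral_const_mul]
    unfold heatMoment
    rw [← Real.norm_eq_abs]
    exact norm_integral_le_of_norm_le (heatMoment_bound_integrable j hS x (w x))
      (ae_of_all _ fun y => heatMoment_integrand_le hw j hs h2 (x := x) (x₀ := x) (by simp) y)
  have hp := heatMoment_zero_pos hw hs x
  unfold normMoment
  rw [abs_div, abs_of_pos hp, div_le_div_iff₀ hp hc]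
  calc |heatMoment w j s x| * c ≤ (w x * ∫ v, gaussBound j S v) * c := by gcongr
    _ = (∫ v, gaussBound j S v) * (c * w x) := by ring
    _ ≤ _ := by gcongr; exact h s x h1

/-- The Hopf–Cole solution of Burgers' equation with weight `w`. -/
noncomputable def hopfCole (w : ℝ → ℝ) (s x : ℝ) : ℝ := -(normMoment w 1 s x / s)

/-- The time derivative of the Hopf–Cole solution. -/
noncomputable def hopfColeDt (w : ℝ → ℝ) (s x : ℝ) : ℝ :=
  normMoment w 1 s x / s ^ 2 -
    (normMoment w 3 s x - normMoment w 1 s x * normMoment w 2 s x) / (4 * s ^ 3)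

lemma hopfCole_hasDerivAt_time (hw : LogLipschitz w) {s : ℝ} (hs : 0 < s) (x : ℝ) :
    HasDerivAt (fun s => hopfCole w s x) (hopfColeDt w s x) s := by
  refine (((normMoment_hasDerivAt_time hw 1 hs x).div (hasDerivAt_id s) hs.ne').neg).congr_deriv ?_
  unfold hopfColeDt
  simp only [id]
  field_simp
  ring

/-- Derivatives of normalized moments are polynomials in normalized moments, with coefficients
rational in `s`. The space derivatives of the solution are thus expressed by the second and third
cumulants, and Burgers' equation becomes an algebraic identity. -/
lemma hopfCole_isClassicalSolution (hw : LogLipschitz w) :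
    IsClassicalSolution (Ioi 0) (hopfCole w) := by
  have c1 := normMoment_continuousOn hw 1
  have c2 := normMoment_continuousOn hw 2
  have c3 := normMoment_continuousOn hw 3
  have cs : ContinuousOn (fun p : ℝ × ℝ => p.1) (Ioi 0 ×ˢ univ) := by fun_prop
  have ns : ∀ p ∈ (Ioi (0 : ℝ) ×ˢ (univ : Set ℝ)), p.1 ≠ 0 := fun p hp => ne_of_gt hp.1
  have n2 : ∀ p ∈ (Ioi (0 : ℝ) ×ˢ (univ : Set ℝ)), 2 * p.1 ≠ 0 := fun p hp =>
    mul_ne_zero two_ne_zero (ns p hp)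
  refine IsClassicalSolution.of_hasDerivAt
    (ut := hopfColeDt w)
    (ux := fun s x => -((-1 + (normMoment w 2 s x - normMoment w 1 s x ^ 2) / (2 * s)) / s))
    (uxx := fun s x => -((normMoment w 3 s x - 3 * normMoment w 1 s x * normMoment w 2 s x +
      2 * normMoment w 1 s x ^ 3) / (4 * s ^ 3)))
    (fun s hs x => hopfCole_hasDerivAt_time hw hs x) (fun s hs x => ?_) (fun s hs x => ?_)
    (c1.div cs ns).neg ?_ ?_ ?_ (fun s hs x => ?_)
  · have hs' : 0 < s := hs
    refine (((normMoment_hasDerivAt_space hw 1 hs x).div_const s).neg).congr_deriv ?_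
    rw [normMoment_zero hw hs]
    norm_num
    ring
  · have hs' : 0 < s := hs
    have h1 := normMoment_hasDerivAt_space hw 1 hs x
    have h2 := normMoment_hasDerivAt_space hw 2 hs x
    refine ((((((h2.sub (h1.pow 2)).div_const (2 * s))).const_add (-1)).div_const s).neg).congr_deriv
      ?_
    rw [show 1 - 1 = 0 from rfl, normMoment_zero hw hs]
    norm_num
    field_simp
    ring
  · refine (c1.div (cs.pow 2) fun p hp => pow_ne_zero _ (ns p hp)).sub
      ((c3.sub (c1.mul c2)).div (continuousOn_const.mul (cs.pow 3))
        fun p hp => mul_ne_zero four_ne_zero (pow_ne_zero _ (ns p hp)))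
  · exact ((continuousOn_const.add ((c2.sub (c1.pow 2)).div (continuousOn_const.mul cs) n2)).div
      cs ns).neg
  · exact (((c3.sub ((continuousOn_const.mul c1).mul c2)).add
      (continuousOn_const.mul (c1.pow 3))).div (continuousOn_const.mul (cs.pow 3))
        fun p hp => mul_ne_zero four_ne_zero (pow_ne_zero _ (ns p hp))).neg
  · have hs' : 0 < s := hs
    unfold hopfColeDt hopfCole
    field_simp
    ring

lemma hopfCole_bounded (hw : LogLipschitz w) {S : ℝ} (hS : 0 < S) :
    ∃ K : ℝ, 0 ≤ K ∧ ∀ s x : ℝ, 1 ≤ s → s ≤ S → |hopfCole w s x| ≤ K := by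
  obtain ⟨K, hK, h⟩ := normMoment_bounded hw 1 hS
  refine ⟨K, hK, fun s x h1 h2 => ?_⟩
  have hs : 0 < s := by linarith
  unfold hopfCole
  rw [abs_neg, abs_div, abs_of_pos hs]
  exact (div_le_self (abs_nonneg _) h1).trans (h s x h1 h2)

lemma hopfColeDt_bounded (hw : LogLipschitz w) {S : ℝ} (hS : 0 < S) :
    ∃ K : ℝ, 0 ≤ K ∧ ∀ s x : ℝ, 1 ≤ s → s ≤ S → |hopfColeDt w s x| ≤ K := by
  obtain ⟨K1, hK1, h1⟩ := normMoment_bounded hw 1 hS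
  obtain ⟨K2, hK2, h2⟩ := normMoment_bounded hw 2 hS
  obtain ⟨K3, hK3, h3⟩ := normMoment_bounded hw 3 hS
  refine ⟨K1 + (K3 + K1 * K2), by positivity, fun s x hs hsS => ?_⟩
  have hs0 : 0 < s := by linarith
  unfold hopfColeDt
  refine (abs_sub _ _).trans (add_le_add ?_ ?_)
  · rw [abs_div, abs_of_pos (show 0 < s ^ 2 by positivity)]
    exact (div_le_self (abs_nonneg _) (one_le_pow₀ hs)).trans (h1 s x hs hsS)
  · rw [abs_div, abs_of_pos (show 0 < 4 * s ^ 3 by positivity)]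
    refine (div_le_self (abs_nonneg _) ?_).trans ?_
    · linarith [one_le_pow₀ hs (n := 3)]
    · refine (abs_sub _ _).trans ?_
      rw [abs_mul]
      gcongr
      · exact h3 s x hs hsS
      · exact h1 s x hs hsS
      · exact h2 s x hs hsS

lemma hopfCole_continuous_space (hw : LogLipschitz w) {s : ℝ} (hs : 0 < s) :
    Continuous (hopfCole w s) :=
  ((hopfCole_isClassicalSolution hw).contDiff_space s hs).continuous

/-- Time is shifted so that the Cauchy datum is the Hopf–Cole solution at time `1`, where it is
already smooth and bounded; the singular limit `s → 0` never has to be studied. -/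
lemma IsClassicalSolution.comp_add_one {u : ℝ → ℝ → ℝ} (H : IsClassicalSolution (Ioi 0) u) :
    IsClassicalSolution (Ioi 0) (fun t => u (t + 1)) := by
  have hmap : MapsTo (fun p : ℝ × ℝ => (p.1 + 1, p.2)) (Ioi 0 ×ˢ univ) (Ioi 0 ×ˢ univ) :=
    fun p hp => ⟨by have : (0 : ℝ) < p.1 := hp.1; exact add_pos this one_pos, trivial⟩
  have hc : ContinuousOn (fun p : ℝ × ℝ => (p.1 + 1, p.2)) (Ioi 0 ×ˢ univ) := by fun_prop
  have hpos : ∀ t : ℝ, t ∈ Ioi (0 : ℝ) → t + 1 ∈ Ioi (0 : ℝ) := fun t ht =>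
    add_pos (show (0 : ℝ) < t from ht) one_pos
  have hd : ∀ t x : ℝ, deriv (fun s => u (s + 1) x) t = deriv (fun s => u s x) (t + 1) :=
    fun t x => deriv_comp_add_const (fun s => u s x) 1 t
  have hcomp : ∀ F : ℝ × ℝ → ℝ, ContinuousOn F (Ioi 0 ×ˢ univ) →
      ContinuousOn (fun p : ℝ × ℝ => F (p.1 + 1, p.2)) (Ioi 0 ×ˢ univ) :=
    fun F hF => hF.comp hc hmap
  constructor
  · exact hcomp _ H.continuousOn
  · intro t ht x
    have h1 := H.differentiableAt_time _ (hpos t ht) x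
    exact h1.comp t (f := fun t => t + 1) (by fun_prop)
  · exact fun t ht => H.contDiff_space _ (hpos t ht)
  · simp only [hd]
    exact hcomp _ H.continuousOn_dt
  · exact hcomp _ H.continuousOn_dx
  · exact hcomp _ H.continuousOn_dxx
  · intro t ht x
    rw [hd]
    exact H.equation _ (hpos t ht) x

lemma hopfCole_tendstoUniformly (hw : LogLipschitz w) {t : ℝ} (ht : 0 < t) :
    TendstoUniformly (fun t => hopfCole w (t + 1)) (hopfCole w (t + 1)) (𝓝 t) := by
  obtain ⟨K, hK, h⟩ := hopfColeDt_bounded hw (S := 2 * t + 1) (by linarith)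
  rw [Metric.tendstoUniformly_iff]
  intro ε hε
  have h1 : ∀ᶠ r in 𝓝 t, r ∈ Ioo 0 (2 * t) := Ioo_mem_nhds ht (by linarith)
  have h2 : ∀ᶠ r in 𝓝 t, r ∈ Metric.ball t (ε / (K + 1)) :=
    Metric.ball_mem_nhds t (by positivity)
  filter_upwards [h1, h2] with r hr1 hr2 x
  have hmv := (convex_Icc (1 : ℝ) (2 * t + 1)).norm_image_sub_le_of_norm_hasDerivWithin_le
    (f := fun s => hopfCole w s x) (f' := fun s => hopfColeDt w s x) (C := K)
    (x := r + 1) (y := t + 1)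
    (fun s hs => (hopfCole_hasDerivAt_time hw (by linarith [hs.1]) x).hasDerivWithinAt)
    (fun s hs => h s x hs.1 hs.2) ⟨by linarith [hr1.1], by linarith [hr1.2]⟩
    ⟨by linarith, by linarith⟩
  rw [Real.dist_eq, ← Real.norm_eq_abs]
  refine hmv.trans_lt ?_
  rw [Metric.mem_ball, dist_comm, Real.dist_eq, lt_div_iff₀ (by positivity)] at hr2
  rw [add_sub_add_right_eq_sub, Real.norm_eq_abs]
  nlinarith [abs_nonneg (t - r)]

lemma hopfCole_tendsto_weakStar (hw : LogLipschitz w) {g : ℝ → ℝ} (hg : Integrable g) :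
    Tendsto (fun t => ∫ x, hopfCole w (t + 1) x * g x) (𝓝[>] (0 : ℝ))
      (𝓝 (∫ x, hopfCole w 1 x * g x)) := by
  obtain ⟨K, hK, h⟩ := hopfCole_bounded hw (S := 2) (by norm_num)
  have h1 : ∀ᶠ t : ℝ in 𝓝[>] 0, t ∈ Ioo (0 : ℝ) 1 := Ioo_mem_nhdsGT one_pos
  refine tendsto_integral_filter_of_dominated_convergence (fun x => K * ‖g x‖) ?_ ?_
    (hg.norm.const_mul K) (ae_of_all _ fun x => ?_)
  · filter_upwards [h1] with t ht
    exact (hopfCole_continuous_space hw (by linarith [ht.1])).aestronglyMeasurable.mul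
      hg.aestronglyMeasurable
  · filter_upwards [h1] with t ht
    refine ae_of_all _ fun x => ?_
    rw [norm_mul]
    gcongr
    exact h _ x (by linarith [ht.1]) (by linarith [ht.2])
  · have hcont : ContinuousAt (fun t => hopfCole w (t + 1) x) 0 := by
      refine ContinuousAt.comp (g := fun s => hopfCole w s x) ?_ (by fun_prop)
      exact (hopfCole_hasDerivAt_time hw (by norm_num) x).continuousAt
    have := hcont.tendsto.mono_left (nhdsWithin_le_nhds (s := Ioi 0))
    rw [zero_add] at this
    exact this.mul_const _

lemma hopfCole_isCauchySolution (hw : LogLipschitz w) :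
    IsCauchySolution (hopfCole w 1) (fun t => hopfCole w (t + 1)) where
  classical := (hopfCole_isClassicalSolution hw).comp_add_one
  bounded t ht := by
    obtain ⟨K, -, h⟩ := hopfCole_bounded hw (S := t + 1) (by linarith)
    exact ⟨K, fun x => h _ x (by linarith) le_rfl⟩
  continuous_sup _ ht := hopfCole_tendstoUniformly hw ht
  weakStar _ hg := hopfCole_tendsto_weakStar hw hg

lemma hopfCole_memLp (hw : LogLipschitz w) : MemLp (hopfCole w 1) ⊤ volume := by
  obtain ⟨K, hK, h⟩ := hopfCole_bounded hw (S := 1) (by norm_num)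
  exact memLp_top_of_bound (hopfCole_continuous_space hw one_pos).aestronglyMeasurable K
    (ae_of_all _ fun x => h 1 x le_rfl le_rfl)

end Moments


/-! ### Weights that evolve exactly into the profiles. -/

/-- The logarithmic derivative `-2 ∂ₓ log (γ + cosh (k x))`, where `p = (γ, k)` and `γ ≥ 0`. -/
noncomputable def profile (p : ℝ × ℝ) (x : ℝ) : ℝ :=
  -2 * p.2 * Real.sinh (p.2 * x) / (|p.1| + Real.cosh (p.2 * x))

lemma LogLipschitz.const_mul {w : ℝ → ℝ} (hw : LogLipschitz w) {c : ℝ} (hc : 0 < c) :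
    LogLipschitz fun y => c * w y := by
  refine ⟨fun y => mul_pos hc (hw.pos y), fun x y => ?_⟩
  rw [mul_left_comm]
  exact mul_le_mul_of_nonneg_left (hw.le x y) hc.le

lemma logLipschitz_exp {k : ℝ} (hk : |k| ≤ 1) : LogLipschitz fun y => Real.exp (k * y) := by
  refine ⟨fun y => Real.exp_pos _, fun x y => ?_⟩
  rw [← Real.exp_add, Real.exp_le_exp]
  have h1 : k * (y - x) ≤ |k| * |y - x| := (le_abs_self _).trans (abs_mul _ _).le
  have h2 : |k| * |y - x| ≤ 1 * |y - x| := by gcongr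
  linarith

lemma logLipschitz_add_cosh {a k : ℝ} (ha : 0 ≤ a) (hk : |k| ≤ 1) :
    LogLipschitz fun y => a + Real.cosh (k * y) := by
  refine ⟨fun y => add_pos_of_nonneg_of_pos ha (Real.cosh_pos _), fun x y => ?_⟩
  have h1 := (logLipschitz_exp hk).le x y
  have h2 := (logLipschitz_exp (k := -k) (by rwa [abs_neg])).le x y
  have h3 : a ≤ Real.exp |y - x| * a := le_mul_of_one_le_left ha (Real.one_le_exp (abs_nonneg _))
  simp only [neg_mul] at h2
  rw [Real.cosh_eq, Real.cosh_eq]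
  linarith

lemma heatMoment_exp {k s : ℝ} (hs : 0 < s) (x : ℝ) :
    ∫ y, (y - x) ^ 0 * Real.exp (-(y - x) ^ 2 / (4 * s)) * Real.exp (k * y) =
      Real.exp (k ^ 2 * s) * Real.exp (k * x) * √(4 * Real.pi * s) := by
  have h : ∀ y : ℝ, (y - x) ^ 0 * Real.exp (-(y - x) ^ 2 / (4 * s)) * Real.exp (k * y) =
      Real.exp (k ^ 2 * s) * Real.exp (k * x) *
        Real.exp (-(1 / (4 * s)) * (y - (x + 2 * k * s)) ^ 2) := fun y => by
    rw [pow_zero, one_mul, ← Real.exp_add, ← Real.exp_add, ← Real.exp_add]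
    congr 1
    field_simp
    ring
  simp only [h]
  rw [integral_const_mul,
    integral_sub_right_eq_self (fun y => Real.exp (-(1 / (4 * s)) * y ^ 2)) (x + 2 * k * s),
    integral_gaussian]
  congr 2
  field_simp

lemma heatMoment_zero_cosh {a k s : ℝ} (c : ℝ) (hk : |k| ≤ 1) (hs : 0 < s) (x : ℝ) :
    heatMoment (fun y => c * (a + Real.cosh (k * y))) 0 s x =
      c * (a + Real.exp (k ^ 2 * s) * Real.cosh (k * x)) * √(4 * Real.pi * s) := by
  have i0 := heatMoment_integrable (logLipschitz_exp (k := 0) (by simp)) 0 hs x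
  have i1 := heatMoment_integrable (logLipschitz_exp hk) 0 hs x
  have i2 := heatMoment_integrable (logLipschitz_exp (k := -k) (by rwa [abs_neg])) 0 hs x
  have e : ∀ y : ℝ, (y - x) ^ 0 * Real.exp (-(y - x) ^ 2 / (4 * s)) *
      (c * (a + Real.cosh (k * y))) =
      c * a * ((y - x) ^ 0 * Real.exp (-(y - x) ^ 2 / (4 * s)) * Real.exp (0 * y)) +
      (c / 2 * ((y - x) ^ 0 * Real.exp (-(y - x) ^ 2 / (4 * s)) * Real.exp (k * y)) +
      c / 2 * ((y - x) ^ 0 * Real.exp (-(y - x) ^ 2 / (4 * s)) * Real.exp (-k * y))) := fun y => by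
    rw [Real.cosh_eq, zero_mul, Real.exp_zero, neg_mul]
    ring
  unfold heatMoment
  simp only [e]
  rw [integral_add, integral_add, integral_const_mul, integral_const_mul,
    integral_const_mul, heatMoment_exp hs, heatMoment_exp hs, heatMoment_exp hs, Real.cosh_eq]
  · simp
    ring
  · exact i1.const_mul _
  · exact i2.const_mul _
  · exact i0.const_mul _
  · exact (i1.const_mul _).add (i2.const_mul _)

/-- No second integral is needed: the zeroth moment has space derivative equal to the first moment
over `2 s`, so differentiating its closed form suffices. -/
lemma heatMoment_one_cosh {a k s c : ℝ} (ha : 0 ≤ a) (hc : 0 < c) (hk : |k| ≤ 1) (hs : 0 < s)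
    (x : ℝ) :
    heatMoment (fun y => c * (a + Real.cosh (k * y))) 1 s x =
      2 * s * (c * (Real.exp (k ^ 2 * s) * (k * Real.sinh (k * x))) * √(4 * Real.pi * s)) := by
  have h1 := heatMoment_hasDerivAt_space ((logLipschitz_add_cosh ha hk).const_mul hc) 0 hs x
  rw [funext fun x => heatMoment_zero_cosh (a := a) c hk hs x] at h1
  have h2 : HasDerivAt (fun x => c * (a + Real.exp (k ^ 2 * s) * Real.cosh (k * x)) *
      √(4 * Real.pi * s))
      (c * (Real.exp (k ^ 2 * s) * (Real.sinh (k * x) * (k * 1))) * √(4 * Real.pi * s)) x :=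
    (((((((hasDerivAt_id x).const_mul k).cosh).const_mul (Real.exp (k ^ 2 * s))).const_add a).const_mul
      c).mul_const _)
  have h3 := h1.unique h2
  simp only [Nat.cast_zero, zero_mul, neg_zero, zero_add] at h3
  rw [div_eq_iff (by positivity)] at h3
  rw [h3]
  ring

lemma hopfCole_cosh {γ k s c : ℝ} (hγ : 0 ≤ γ) (hc : 0 < c) (hk : |k| ≤ 1) (hs : 0 < s) (x : ℝ) :
    hopfCole (fun y => c * (γ * Real.exp (k ^ 2 * s) + Real.cosh (k * y))) s x =
      profile (γ, k) x := by
  have h0 : 0 < √(4 * Real.pi * s) := Real.sqrt_pos.2 (by positivity)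
  have h1 : γ + Real.cosh (k * x) ≠ 0 :=
    (add_pos_of_nonneg_of_pos hγ (Real.cosh_pos _)).ne'
  unfold hopfCole normMoment profile
  rw [heatMoment_one_cosh (by positivity) hc hk hs, heatMoment_zero_cosh c hk hs, abs_of_nonneg hγ,
    show γ * Real.exp (k ^ 2 * s) + Real.exp (k ^ 2 * s) * Real.cosh (k * x) =
      Real.exp (k ^ 2 * s) * (γ + Real.cosh (k * x)) by ring]
  have h2 := Real.exp_pos (k ^ 2 * s)
  field_simp

/-! ### Localization: only a distant annulus of the weight matters. -/

lemma integrable_exp_neg_abs : Integrable fun y : ℝ => Real.exp (-|y|) := by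
  rw [← integrableOn_univ, ← Iic_union_Ioi (a := (0 : ℝ))]
  refine IntegrableOn.union ?_ ?_
  · refine (integrableOn_exp_Iic 0).congr_fun (fun y hy => ?_) measurableSet_Iic
    simp only [abs_of_nonpos (mem_Iic.1 hy), neg_neg]
  · refine (integrableOn_exp_neg_Ioi 0).congr_fun (fun y hy => ?_) measurableSet_Ioi
    simp only [abs_of_pos (mem_Ioi.1 hy)]

/-- Two log-Lipschitz weights that agree on a long annulus have nearby moments. -/
lemma heatMoment_sub_le {v w : ℝ → ℝ} (hv : LogLipschitz v) (hw : LogLipschitz w)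
    {r R s X x : ℝ} (hr : 0 ≤ r) (hs : 0 < s) (hrR : r ≤ R) (hXR : 2 * X ≤ R) (hR : 64 * s ≤ R)
    (hvw : ∀ y, r ≤ |y| → |y| ≤ R → w y = v y) (hx : |x| ≤ X) {j : ℕ} (hj : j ≤ 1) :
    |heatMoment w j s x - heatMoment v j s x| ≤
      v r * ((1 + r + X) * Real.exp (3 * r + X) * ∫ y : ℝ, Real.exp (-|y|)) := by
  have hX : 0 ≤ X := (abs_nonneg x).trans hx
  have hm : w r = v r := hvw r (le_abs_self r) (by rwa [abs_of_nonneg hr])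
  have hm0 := hv.pos r
  -- The weights agree at `r`, so propagating the log-Lipschitz bound from `r` controls both of them
  -- everywhere by the single number `v r`.
  have hdiff : ∀ y, |w y - v y| ≤ v r * Real.exp (|y| + r) := fun y => by
    have h1 : |y - r| ≤ |y| + r := (abs_sub _ _).trans (by rw [abs_of_nonneg hr])
    have h2 : v y ≤ v r * Real.exp (|y| + r) := by
      rw [mul_comm]
      exact (hv.le r y).trans (by gcongr)
    have h3 : w y ≤ v r * Real.exp (|y| + r) := by
      rw [mul_comm, ← hm]
      exact (hw.le r y).trans (by rw [hm]; gcongr)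
    rw [abs_le]
    constructor <;> linarith [hv.pos y, hw.pos y]
  have hpow : ∀ y, |(y - x) ^ j| ≤ 1 + |y| + X := fun y => by
    have h1 : |y - x| ≤ |y| + X := (abs_sub _ _).trans (by linarith)
    interval_cases j
    · simp only [pow_zero, abs_one]; linarith [abs_nonneg y]
    · rw [pow_one]; linarith
  unfold heatMoment
  rw [← integral_sub (heatMoment_integrable hw j hs x) (heatMoment_integrable hv j hs x),
    ← integral_const_mul, ← integral_const_mul, ← Real.norm_eq_abs]
  refine norm_integral_le_of_norm_le ((integrable_exp_neg_abs.const_mul _).const_mul _)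
    (ae_of_all _ fun y => ?_)
  rw [Real.norm_eq_abs, ← mul_sub, abs_mul, abs_mul, Real.abs_exp]
  rcases lt_or_ge |y| r with hy | hy
  · have hE : Real.exp (-(y - x) ^ 2 / (4 * s)) ≤ 1 := by
      rw [Real.exp_le_one_iff, neg_div, neg_nonpos]
      positivity
    calc |(y - x) ^ j| * Real.exp (-(y - x) ^ 2 / (4 * s)) * |w y - v y|
        ≤ (1 + r + X) * 1 * (v r * Real.exp (3 * r + X + -|y|)) := by
          gcongr
          · exact (hpow y).trans (by linarith)
          · refine (hdiff y).trans ?_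
            refine mul_le_mul_of_nonneg_left (Real.exp_le_exp.2 ?_) hm0.le
            linarith
      _ = _ := by rw [Real.exp_add]; ring
  rcases le_or_gt |y| R with hyR | hyR
  · rw [hvw y hy hyR]
    simp only [sub_self, abs_zero, mul_zero]
    positivity
  -- Here `|y - x| ≥ |y| / 2` because `2 * X ≤ R`, so the exponent is at most `-y² / (16 s)`; the
  -- constant `64` turns this into `-4 |y|`, enough to absorb the weights and the polynomial factor.
  · have hE : -(y - x) ^ 2 / (4 * s) ≤ -(4 * |y|) := by
      have h1 : |y| / 2 ≤ |y - x| := by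
        have := abs_sub_abs_le_abs_sub y x
        linarith
      have h2 : (|y| / 2) ^ 2 ≤ (y - x) ^ 2 := by
        rw [← sq_abs (y - x)]
        gcongr
      rw [neg_div, neg_le_neg_iff, le_div_iff₀ (by positivity)]
      nlinarith [abs_nonneg y]
    have hP : 1 + |y| + X ≤ Real.exp (|y| + X) := by
      linarith [Real.add_one_le_exp (|y| + X)]
    calc |(y - x) ^ j| * Real.exp (-(y - x) ^ 2 / (4 * s)) * |w y - v y|
        ≤ Real.exp (|y| + X) * Real.exp (-(4 * |y|)) * (v r * Real.exp (|y| + r)) := by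
          gcongr
          · exact (hpow y).trans hP
          · exact hdiff y
      _ = v r * (1 * Real.exp (|y| + X + -(4 * |y|) + (|y| + r))) := by
          rw [Real.exp_add _ (|y| + r), Real.exp_add _ (-(4 * |y|))]; ring
      _ ≤ v r * ((1 + r + X) * Real.exp (3 * r + X + -|y|)) := by
          refine mul_le_mul_of_nonneg_left (mul_le_mul (by linarith) (Real.exp_le_exp.2 ?_)
            (Real.exp_pos _).le (by linarith)) hm0.le
          linarith [abs_nonneg y]
      _ = _ := by rw [Real.exp_add]; ring

/-- Stability of the quotient defining the Hopf–Cole solution. In the application `m` is the weight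
at the inner radius and `q = √s`; the scale `m` cancels, leaving an error that decays with `s`. -/
lemma abs_div_sub_div_le {n₀ n₁ v₀ v₁ m K q s : ℝ} (hm : 0 < m) (hK : 0 ≤ K) (hq : 0 < q)
    (hs : 1 ≤ s) (h0 : |n₀ - v₀| ≤ m * K) (h1 : |n₁ - v₁| ≤ m * K) (hv : m * q ≤ v₀)
    (hqK : 2 * K ≤ q) (hv1 : |v₁| ≤ 2 * s * v₀) :
    |n₁ / n₀ / s - v₁ / v₀ / s| ≤ 6 * K / q := by
  have hv0 : 0 < v₀ := (mul_pos hm hq).trans_le hv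
  have hn : v₀ / 2 ≤ n₀ := by
    have := (abs_le.1 h0).1
    nlinarith
  have hn0 : 0 < n₀ := by linarith
  have hs0 : 0 < s := by linarith
  have e : n₁ / n₀ / s - v₁ / v₀ / s =
      ((n₁ - v₁) * v₀ + v₁ * (v₀ - n₀)) / (n₀ * v₀ * s) := by
    field_simp
    ring
  have hnum : |(n₁ - v₁) * v₀ + v₁ * (v₀ - n₀)| ≤ 3 * s * v₀ * (m * K) := by
    refine (abs_add_le _ _).trans ?_
    rw [abs_mul, abs_mul, abs_of_pos hv0, abs_sub_comm v₀]
    have a1 : |n₁ - v₁| * v₀ ≤ m * K * v₀ := by gcongr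
    have a2 : |v₁| * |n₀ - v₀| ≤ 2 * s * v₀ * (m * K) := by gcongr
    have a3 : m * K * v₀ ≤ s * (m * K * v₀) := le_mul_of_one_le_left (by positivity) hs
    linarith
  rw [e, abs_div, abs_of_pos (show 0 < n₀ * v₀ * s by positivity),
    div_le_div_iff₀ (by positivity) hq]
  calc _ ≤ 3 * s * v₀ * (m * K) * q := by gcongr
    _ = 3 * s * v₀ * K * (m * q) := by ring
    _ ≤ 3 * s * v₀ * K * (2 * n₀) := by
        refine mul_le_mul_of_nonneg_left ?_ (by positivity)
        linarith
    _ = _ := by ring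

/-- If a log-Lipschitz weight is proportional to `γ exp (k² s) + cosh (k y)` on a sufficiently long
annulus, then at a suitable time `s` the corresponding solution is close to a given profile. -/
lemma exists_hopfCole_sub_profile_le {γ k r X ε : ℝ} (hγ : 0 ≤ γ) (hk : 0 < k) (hk1 : k ≤ 1)
    (hr : 0 ≤ r) (hX : 0 ≤ X) (hε : 0 < ε) :
    ∃ s R : ℝ, X + 1 ≤ s ∧ r + 1 ≤ R ∧ ∀ w, LogLipschitz w → ∀ c : ℝ, 0 < c →
      (∀ y, r ≤ |y| → |y| ≤ R → w y = c * (γ * Real.exp (k ^ 2 * s) + Real.cosh (k * y))) →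
      ∀ x, |x| ≤ X → |hopfCole w s x - profile (γ, k) x| ≤ ε := by
  set K := (1 + r + X) * Real.exp (3 * r + X) * ∫ y : ℝ, Real.exp (-|y|) with hKdef
  have hK : 0 ≤ K := by
    have : 0 ≤ ∫ y : ℝ, Real.exp (-|y|) := integral_nonneg fun y => (Real.exp_pos _).le
    positivity
  have hkk : |k| ≤ 1 := by rwa [abs_of_pos hk]
  -- `K` does not depend on `s`. The summands ensure in turn `s ≥ X + 1`, `k² s ≥ r`, a perturbed
  -- denominator at least half the exact one, and a final error at most `ε`.
  obtain ⟨s, hs⟩ : ∃ s, s = X + 1 + r / k ^ 2 + (2 * K) ^ 2 + (6 * K / ε) ^ 2 := ⟨_, rfl⟩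
  have hp1 : 0 ≤ r / k ^ 2 := by positivity
  have hp2 := sq_nonneg (2 * K)
  have hp3 := sq_nonneg (6 * K / ε)
  have hs1 : 1 ≤ s := by linarith
  have hs0 : 0 < s := by linarith
  have hsr : r ≤ k ^ 2 * s := by
    rw [mul_comm, ← div_le_iff₀ (by positivity)]
    linarith
  have hq1 : 2 * K ≤ √s := Real.le_sqrt_of_sq_le (by linarith)
  have hq2 : 6 * K / ε ≤ √s := Real.le_sqrt_of_sq_le (by linarith)
  have hq0 : 0 < √s := Real.sqrt_pos.2 hs0
  refine ⟨s, r + 1 + 2 * X + 64 * s, by linarith, by linarith, fun w hw c hc hwv x hx => ?_⟩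
  set v : ℝ → ℝ := fun y => c * (γ * Real.exp (k ^ 2 * s) + Real.cosh (k * y)) with hv
  have hvL : LogLipschitz v := (logLipschitz_add_cosh (by positivity) hkk).const_mul hc
  have hd : ∀ j ≤ 1, |heatMoment w j s x - heatMoment v j s x| ≤ v r * K := fun j hj =>
    heatMoment_sub_le hvL hw hr hs0 (R := r + 1 + 2 * X + 64 * s) (by linarith) (by linarith)
      (by linarith) hwv hx hj
  have hpi : √s ≤ √(4 * Real.pi * s) := Real.sqrt_le_sqrt
    (le_mul_of_one_le_left hs0.le (by linarith [Real.pi_gt_three]))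
  have hmain : v r * √s ≤ heatMoment v 0 s x := by
    rw [hv, heatMoment_zero_cosh c hkk hs0]
    -- By time `s` the growth factor of the hyperbolic mode has overtaken the weight at radius `r`;
    -- positivity of `k` is essential here.
    have h1 : Real.cosh (k * r) ≤ Real.exp (k ^ 2 * s) * Real.cosh (k * x) := by
      have hkr : 0 ≤ k * r := by positivity
      have a1 : Real.cosh (k * r) ≤ Real.exp (k * r) := by
        rw [Real.cosh_eq]
        have := Real.exp_le_exp.2 (show -(k * r) ≤ k * r by linarith)
        linarith
      have a2 : Real.exp (k * r) ≤ Real.exp (k ^ 2 * s) :=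
        Real.exp_le_exp.2 ((mul_le_of_le_one_left hr hk1).trans hsr)
      exact a1.trans (a2.trans (le_mul_of_one_le_right (Real.exp_pos _).le (Real.one_le_cosh _)))
    change c * (γ * Real.exp (k ^ 2 * s) + Real.cosh (k * r)) * √s ≤ _
    gcongr
  have hv1 : |heatMoment v 1 s x| ≤ 2 * s * heatMoment v 0 s x := by
    rw [hv, heatMoment_zero_cosh c hkk hs0, heatMoment_one_cosh (by positivity) hc hkk hs0, abs_mul,
      abs_mul (c * _), abs_mul c, abs_mul (Real.exp _), abs_mul k, Real.abs_exp, abs_of_pos hc,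
      abs_of_pos hk, abs_of_pos (show 0 < 2 * s by positivity), abs_of_nonneg (Real.sqrt_nonneg _)]
    have h1 : k * |Real.sinh (k * x)| ≤ Real.cosh (k * x) := by
      refine (mul_le_of_le_one_left (abs_nonneg _) hk1).trans ?_
      rw [Real.abs_sinh, ← Real.cosh_abs]
      exact (Real.sinh_lt_cosh _).le
    have h2 : Real.exp (k ^ 2 * s) * (k * |Real.sinh (k * x)|) ≤
        γ * Real.exp (k ^ 2 * s) + Real.exp (k ^ 2 * s) * Real.cosh (k * x) := by
      have : 0 ≤ γ * Real.exp (k ^ 2 * s) := by positivity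
      have := mul_le_mul_of_nonneg_left h1 (Real.exp_pos (k ^ 2 * s)).le
      linarith
    gcongr
  rw [← hopfCole_cosh hγ hc hkk hs0]
  change |-(heatMoment w 1 s x / heatMoment w 0 s x / s) -
    -(heatMoment v 1 s x / heatMoment v 0 s x / s)| ≤ ε
  rw [neg_sub_neg, abs_sub_comm]
  refine (abs_div_sub_div_le (hvL.pos r) hK hq0 hs1 (hd 0 (by norm_num)) (hd 1 le_rfl) hmain hq1
    hv1).trans ?_
  rw [div_le_iff₀ hq0]
  rwa [div_le_iff₀ hε, mul_comm _ ε] at hq2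


/-! ### Gluing Lipschitz functions along increasing radii. -/

/-- Successive gluing of (increments of) the functions `L n` at the points `ρ n`. -/
noncomputable def glue (ρ : ℕ → ℝ) (L : ℕ → ℝ → ℝ) : ℕ → ℝ → ℝ
  | 0, _ => 0
  | n + 1, y => glue ρ L n (min y (ρ n)) + L n (max y (ρ n)) - L n (ρ n)

section Glue

variable {ρ : ℕ → ℝ} {L : ℕ → ℝ → ℝ}

lemma abs_glue_sub_le (hL : ∀ n x y, |L n x - L n y| ≤ |x - y|) (n : ℕ) (x y : ℝ) :
    |glue ρ L n x - glue ρ L n y| ≤ |x - y| := by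
  induction n generalizing x y with
  | zero => simp [glue]
  | succ n ih =>
    -- Cutting the interval between `x` and `y` at `ρ n` splits its length additively, so gluing
    -- does not increase the Lipschitz constant.
    have h : |min x (ρ n) - min y (ρ n)| + |max x (ρ n) - max y (ρ n)| = |x - y| := by
      rcases le_total x (ρ n) with hx | hx <;> rcases le_total y (ρ n) with hy | hy
      · simp [hx, hy]
      · rw [min_eq_left hx, min_eq_right hy, max_eq_right hx, max_eq_left hy,
          abs_of_nonpos (by linarith), abs_of_nonpos (by linarith), abs_of_nonpos (by linarith)]
        ring
      · rw [min_eq_left hy, min_eq_right hx, max_eq_right hy, max_eq_left hx,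
          abs_of_nonneg (by linarith), abs_of_nonneg (by linarith), abs_of_nonneg (by linarith)]
        ring
      · simp [hx, hy]
    have e : glue ρ L (n + 1) x - glue ρ L (n + 1) y =
        (glue ρ L n (min x (ρ n)) - glue ρ L n (min y (ρ n))) +
          (L n (max x (ρ n)) - L n (max y (ρ n))) := by
      simp only [glue]; ring
    rw [e, ← h]
    exact (abs_add_le _ _).trans (add_le_add (ih _ _) (hL n _ _))

lemma glue_eq_of_le (hρ : Monotone ρ) {n m : ℕ} (hnm : n ≤ m) {y : ℝ} (hy : y ≤ ρ n) :
    glue ρ L m y = glue ρ L n y := by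
  induction m, hnm using Nat.le_induction with
  | base => rfl
  | succ m hm ih =>
    have h : y ≤ ρ m := hy.trans (hρ hm)
    simp only [glue, min_eq_left h, max_eq_right h, ih]
    ring

/-- Stages past the first radius beyond `y` no longer change the value at `y`, and `⌈y⌉₊` is always
late enough because `n ≤ ρ n`. The limit is therefore an eventually constant sequence at each point.
-/
lemma exists_glued (hρ : Monotone ρ) (hρn : ∀ n : ℕ, (n : ℝ) ≤ ρ n)
    (hL : ∀ n x y, |L n x - L n y| ≤ |x - y|) :
    ∃ l : ℝ → ℝ, (∀ x y, |l x - l y| ≤ |x - y|) ∧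
      ∀ n, ∃ c, ∀ y, ρ n ≤ y → y ≤ ρ (n + 1) → l y = c + L n y := by
  have key : ∀ (n : ℕ) (y : ℝ), y ≤ ρ n → glue ρ L ⌈y⌉₊ y = glue ρ L n y := fun n y hy => by
    have h1 : y ≤ ρ ⌈y⌉₊ := (Nat.le_ceil y).trans (hρn _)
    rcases le_total ⌈y⌉₊ n with h | h
    · exact (glue_eq_of_le hρ h h1).symm
    · exact glue_eq_of_le hρ h hy
  refine ⟨fun y => glue ρ L ⌈y⌉₊ y, fun x y => ?_, fun n =>
    ⟨glue ρ L n (ρ n) - L n (ρ n), fun y h1 h2 => ?_⟩⟩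
  · have hx : x ≤ ρ (max ⌈x⌉₊ ⌈y⌉₊) :=
      (Nat.le_ceil x).trans ((hρn _).trans (hρ (le_max_left _ _)))
    have hy : y ≤ ρ (max ⌈x⌉₊ ⌈y⌉₊) :=
      (Nat.le_ceil y).trans ((hρn _).trans (hρ (le_max_right _ _)))
    simp only [key _ _ hx, key _ _ hy]
    exact abs_glue_sub_le hL _ _ _
  · simp only [key _ _ h2, glue, min_eq_right h1, max_eq_left h1]
    ring

end Glue

/-! ### One solution shadowing a sequence of profiles. -/

lemma LogLipschitz.abs_log_sub_le {w : ℝ → ℝ} (hw : LogLipschitz w) (x y : ℝ) :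
    |Real.log (w x) - Real.log (w y)| ≤ |x - y| := by
  have h : ∀ x y, Real.log (w y) ≤ |y - x| + Real.log (w x) := fun x y => by
    have := Real.log_le_log (hw.pos y) (hw.le x y)
    rwa [Real.log_mul (Real.exp_pos _).ne' (hw.pos x).ne', Real.log_exp] at this
  have h1 := h x y
  have h2 := h y x
  rw [abs_sub_comm] at h1
  rw [abs_le]
  constructor <;> linarith

/-- Along a suitable sequence of times, a single solution shadows any given sequence of profiles. -/
lemma exists_hopfCole_shadowing (p : ℕ → ℝ × ℝ) (h1 : ∀ n, 0 ≤ (p n).1) (h2 : ∀ n, 0 < (p n).2)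
    (h3 : ∀ n, (p n).2 ≤ 1) :
    ∃ w, LogLipschitz w ∧ ∃ s : ℕ → ℝ, ∀ n : ℕ, (n : ℝ) + 1 ≤ s n ∧
      ∀ x : ℝ, |x| ≤ n → |hopfCole w (s n) x - profile (p n) x| ≤ 1 / (n + 1) := by
  -- The condition `0 ≤ r` sits under the existential so that the chosen time and outer radius are
  -- total functions of `r`, and the radii can be defined by plain recursion.
  have H : ∀ (n : ℕ) (r : ℝ), ∃ s R : ℝ, 0 ≤ r → ((n : ℝ) + 1 ≤ s ∧ r + 1 ≤ R ∧
      ∀ w, LogLipschitz w → ∀ c : ℝ, 0 < c →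
        (∀ y, r ≤ |y| → |y| ≤ R →
          w y = c * ((p n).1 * Real.exp ((p n).2 ^ 2 * s) + Real.cosh ((p n).2 * y))) →
        ∀ x : ℝ, |x| ≤ n → |hopfCole w s x - profile (p n) x| ≤ 1 / (n + 1)) := fun n r => by
    by_cases hr : 0 ≤ r
    · obtain ⟨s, R, h⟩ := exists_hopfCole_sub_profile_le (h1 n) (h2 n) (h3 n) hr
        (X := n) (ε := 1 / (n + 1)) (by positivity) (by positivity)
      exact ⟨s, R, fun _ => h⟩
    · exact ⟨0, 0, fun h => absurd h hr⟩
  choose S R hSR using H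
  let ρ : ℕ → ℝ := fun n => Nat.rec 0 (fun n r => R n r) n
  have hρs : ∀ n, ρ (n + 1) = R n (ρ n) := fun n => rfl
  have hρn : ∀ n : ℕ, (n : ℝ) ≤ ρ n := fun n => by
    induction n with
    | zero => simp [ρ]
    | succ n ih =>
      have := (hSR n (ρ n) ((Nat.cast_nonneg n).trans ih)).2.1
      rw [hρs]
      push_cast
      linarith
  have hρ0 : ∀ n, 0 ≤ ρ n := fun n => (Nat.cast_nonneg n).trans (hρn n)
  have hρ : Monotone ρ := monotone_nat_of_le_succ fun n => by
    have := (hSR n (ρ n) (hρ0 n)).2.1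
    rw [hρs]
    linarith
  let s : ℕ → ℝ := fun n => S n (ρ n)
  let V : ℕ → ℝ → ℝ := fun n y =>
    (p n).1 * Real.exp ((p n).2 ^ 2 * s n) + Real.cosh ((p n).2 * y)
  have hV : ∀ n, LogLipschitz (V n) := fun n =>
    logLipschitz_add_cosh (mul_nonneg (h1 n) (Real.exp_pos _).le)
      (by rw [abs_of_pos (h2 n)]; exact h3 n)
  obtain ⟨l, hl, hc⟩ := exists_glued (L := fun n y => Real.log (V n y)) hρ hρn
    fun n => (hV n).abs_log_sub_le
  -- The even extension covers both halves of each annulus at once, the model weights being even.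
  have hw : LogLipschitz fun y => Real.exp (l |y|) := by
    refine ⟨fun y => Real.exp_pos _, fun x y => ?_⟩
    rw [← Real.exp_add, Real.exp_le_exp]
    have a1 := (le_abs_self _).trans (hl |y| |x|)
    have a2 := abs_abs_sub_abs_le y x
    linarith
  refine ⟨_, hw, s, fun n => ⟨(hSR n (ρ n) (hρ0 n)).1, ?_⟩⟩
  obtain ⟨c, hc⟩ := hc n
  refine (hSR n (ρ n) (hρ0 n)).2.2 _ hw (Real.exp c) (Real.exp_pos c) fun y hy1 hy2 => ?_
  have hcosh : V n |y| = V n y := by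
    have : (p n).2 * |y| = |(p n).2 * y| := by rw [abs_mul, abs_of_pos (h2 n)]
    simp only [V, this, Real.cosh_abs]
  rw [hc _ hy1 hy2, hcosh, Real.exp_add, Real.exp_log ((hV n).pos y)]

/-! ### Recurrent parameters and the `ω`-limit set. -/

lemma profile_continuous_uncurry : Continuous fun q : (ℝ × ℝ) × ℝ => profile q.1 q.2 := by
  have hs := Real.continuous_sinh
  have hc := Real.continuous_cosh
  unfold profile
  refine Continuous.div (by fun_prop) (by fun_prop) fun q => ?_
  exact (add_pos_of_nonneg_of_pos (abs_nonneg _) (Real.cosh_pos _)).ne'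

lemma profile_memLp (p : ℝ × ℝ) : MemLp (profile p) ⊤ volume := by
  have hc : Continuous (profile p) :=
    profile_continuous_uncurry.comp (by fun_prop : Continuous fun x : ℝ => (p, x))
  refine memLp_top_of_bound hc.aestronglyMeasurable (2 * |p.2|) (ae_of_all _ fun x => ?_)
  have hpos := Real.cosh_pos (p.2 * x)
  have h : |Real.sinh (p.2 * x)| ≤ |p.1| + Real.cosh (p.2 * x) := by
    rw [Real.abs_sinh, ← Real.cosh_abs]
    linarith [Real.sinh_lt_cosh |p.2 * x|, abs_nonneg p.1]
  have hD : 0 < |p.1| + Real.cosh (p.2 * x) := by positivity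
  unfold profile
  rw [Real.norm_eq_abs, abs_div, abs_of_pos hD, div_le_iff₀ hD, abs_mul, abs_mul, abs_neg,
    abs_two]
  gcongr

/-- Joint continuity makes the profile a continuous map from parameters to the compact-open
topology; the absolute value in `profile` makes this valid for all real parameters. -/
lemma profile_tendstoUniformlyOn {ι : Type*} {f : Filter ι} {P : ι → ℝ × ℝ} {q : ℝ × ℝ}
    (hP : Tendsto P f (𝓝 q)) {K : Set ℝ} (hK : IsCompact K) :
    TendstoUniformlyOn (fun i => profile (P i)) (profile q) f K := by
  let F : C((ℝ × ℝ) × ℝ, ℝ) := ⟨fun q => profile q.1 q.2, profile_continuous_uncurry⟩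
  have h := (F.curry.continuous.tendsto q).comp hP
  exact ContinuousMap.tendsto_iff_forall_isCompact_tendstoUniformlyOn.1 h K hK

/-- A sequence of admissible parameters that accumulates at every limit of such parameters. -/
lemma exists_recurrent_parameters :
    ∃ p : ℕ → ℝ × ℝ, (∀ n, 0 ≤ (p n).1 ∧ 0 < (p n).2 ∧ (p n).2 ≤ 1) ∧
      ∀ q : ℝ × ℝ, 0 ≤ q.1 → 0 ≤ q.2 → q.2 ≤ 1 →
        ∀ m : ℕ, ∃ n, m ≤ n ∧ dist (p n) q < 1 / (m + 1) := by
  let A : Set (ℝ × ℝ) := {q | 0 ≤ q.1 ∧ 0 < q.2 ∧ q.2 ≤ 1}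
  have : Nonempty A := ⟨⟨(0, 1), by simp [A]⟩⟩
  -- Reading only the first component of `n.unpair` repeats every term of the dense sequence at
  -- arbitrarily large indices.
  refine ⟨fun n => (TopologicalSpace.denseSeq A n.unpair.1 : A), fun n => (TopologicalSpace.denseSeq A n.unpair.1).2, ?_⟩
  intro q hq1 hq2 hq3 m
  obtain ⟨δ, hδ⟩ : ∃ δ : ℝ, δ = 1 / (m + 1) := ⟨_, rfl⟩
  have hδ0 : 0 < δ := by rw [hδ]; positivity
  have hδ1 : δ ≤ 1 := by
    rw [hδ, div_le_one (by positivity)]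
    linarith [Nat.cast_nonneg (α := ℝ) m]
  -- The target may have `q.2 = 0`, which is not admissible, so it is first moved into `A` by at
  -- most `δ / 2`.
  let a : A := ⟨(q.1, max q.2 (δ / 2)), hq1, lt_max_of_lt_right (by linarith),
    max_le hq3 (by linarith)⟩
  have ha : dist (a : ℝ × ℝ) q ≤ δ / 2 := by
    rw [Prod.dist_eq]
    refine max_le ?_ ?_
    · simp only [a, dist_self]; linarith
    · rw [Real.dist_eq, abs_of_nonneg (by simp [a])]
      rcases le_total q.2 (δ / 2) with h | h
      · simp only [a, max_eq_right h]; linarith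
      · simp only [a, max_eq_left h]; linarith
  obtain ⟨i, hi⟩ := (TopologicalSpace.denseRange_denseSeq A).exists_dist_lt a (half_pos hδ0)
  refine ⟨Nat.pair i m, Nat.right_le_pair i m, ?_⟩
  simp only [Nat.unpair_pair, ← hδ]
  calc _ ≤ dist (TopologicalSpace.denseSeq A i : ℝ × ℝ) a + dist (a : ℝ × ℝ) q :=
        dist_triangle _ _ _
    _ < δ / 2 + δ / 2 := add_lt_add_of_lt_of_le (by rw [dist_comm]; exact hi) ha
    _ = δ := add_halves δ

/-- There are bounded initial data whose `ω`-limit set contains all profiles. -/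
lemma exists_profile_mem_omegaZero :
    ∃ u₀ : ℝ → ℝ, MemLp u₀ ⊤ volume ∧
      ∀ q : ℝ × ℝ, 0 ≤ q.1 → 0 ≤ q.2 → q.2 ≤ 1 → profile q ∈ omegaZero u₀ := by
  obtain ⟨p, hp, hrec⟩ := exists_recurrent_parameters
  obtain ⟨w, hw, s, hs⟩ := exists_hopfCole_shadowing p (fun n => (hp n).1) (fun n => (hp n).2.1)
    (fun n => (hp n).2.2)
  refine ⟨hopfCole w 1, hopfCole_memLp hw, fun q hq1 hq2 hq3 =>
    ⟨profile_memLp q, _, hopfCole_isCauchySolution hw, ?_⟩⟩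
  choose φ hφ hφq using hrec q hq1 hq2 hq3
  have hφ' : ∀ m : ℕ, (m : ℝ) ≤ φ m := fun m => Nat.cast_le.2 (hφ m)
  -- The subtraction undoes the unit time shift in the Cauchy solution.
  refine ⟨fun m => s (φ m) - 1, ?_, fun R => ?_⟩
  · refine tendsto_atTop_mono (fun m => ?_) tendsto_natCast_atTop_atTop
    linarith [(hs (φ m)).1, hφ' m]
  · have hP : Tendsto (fun m => p (φ m)) atTop (𝓝 q) :=
      tendsto_iff_dist_tendsto_zero.2 (squeeze_zero (fun _ => dist_nonneg)
        (fun m => (hφq m).le) tendsto_one_div_add_atTop_nhds_zero_nat)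
    have hU := profile_tendstoUniformlyOn hP (isCompact_Icc (a := -R) (b := R))
    rw [Metric.tendstoUniformlyOn_iff] at hU ⊢
    intro ε hε
    have e1 : ∀ᶠ m : ℕ in atTop, 1 / ((m : ℝ) + 1) < ε / 2 :=
      tendsto_one_div_add_atTop_nhds_zero_nat.eventually_lt_const (half_pos hε)
    have e2 : ∀ᶠ m : ℕ in atTop, R ≤ m := tendsto_natCast_atTop_atTop.eventually_ge_atTop R
    filter_upwards [hU (ε / 2) (half_pos hε), e1, e2] with m hm h1 h2 x hx
    have hx' : |x| ≤ φ m := (abs_le.2 hx).trans (h2.trans (hφ' m))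
    have h3 := (hs (φ m)).2 x hx'
    have h4 : 1 / ((φ m : ℝ) + 1) ≤ 1 / ((m : ℝ) + 1) :=
      one_div_le_one_div_of_le (by positivity) (by linarith [hφ' m])
    rw [sub_add_cancel]
    calc dist (profile q x) (hopfCole w (s (φ m)) x)
        ≤ dist (profile q x) (profile (p (φ m)) x) +
          dist (profile (p (φ m)) x) (hopfCole w (s (φ m)) x) := dist_triangle _ _ _
      _ < ε / 2 + ε / 2 := by
        refine add_lt_add (hm x hx) ?_
        rw [dist_comm, Real.dist_eq]
        linarith
      _ = ε := add_halves ε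


/-! ### The two-shock solution and its asymptotics. -/

lemma psi_eq_profile {γ : ℝ} (hγ : 0 ≤ γ) : psi γ = profile (γ, 1) := by
  funext x
  simp [psi, profile, abs_of_nonneg hγ]

lemma shock_neg_eq_profile (δ : ℝ) : shock δ (-δ) = profile (0, δ / 2) := by
  funext x
  have h : (δ - -δ) / 2 * x / 2 = δ / 2 * x := by ring
  simp only [shock, profile, h, abs_zero, zero_add, Real.tanh_eq_sinh_div_cosh]
  ring

lemma twoShock_denom_pos (t x : ℝ) : 0 < Real.exp (-t) + Real.cosh x :=
  add_pos (Real.exp_pos _) (Real.cosh_pos _)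

lemma twoShock_isClassicalSolution : IsClassicalSolution univ twoShock := by
  have cS : Continuous fun p : ℝ × ℝ => Real.sinh p.2 := Real.continuous_sinh.comp continuous_snd
  have cC : Continuous fun p : ℝ × ℝ => Real.cosh p.2 := Real.continuous_cosh.comp continuous_snd
  have cE : Continuous fun p : ℝ × ℝ => Real.exp (-p.1) := by fun_prop
  have cD := cE.add cC
  have cD0 : ∀ p : ℝ × ℝ, Real.exp (-p.1) + Real.cosh p.2 ≠ 0 := fun p =>
    (twoShock_denom_pos p.1 p.2).ne'
  have hE : ∀ t : ℝ, HasDerivAt (fun t : ℝ => Real.exp (-t)) (-Real.exp (-t)) t := fun t => by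
    simpa using (hasDerivAt_neg t).exp
  refine IsClassicalSolution.of_hasDerivAt
    (ut := fun t x => -2 * Real.sinh x * Real.exp (-t) / (Real.exp (-t) + Real.cosh x) ^ 2)
    (ux := fun t x => -2 * (Real.exp (-t) * Real.cosh x + 1) /
      (Real.exp (-t) + Real.cosh x) ^ 2)
    (uxx := fun t x => -2 * (Real.exp (-t) * Real.sinh x * (Real.exp (-t) + Real.cosh x) -
      2 * (Real.exp (-t) * Real.cosh x + 1) * Real.sinh x) / (Real.exp (-t) + Real.cosh x) ^ 3)
    (fun t _ x => ?_) (fun t _ x => ?_) (fun t _ x => ?_) ?_ ?_ ?_ ?_ (fun t _ x => ?_)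
  · have h := ((hasDerivAt_const t (-2 * Real.sinh x)).div ((hE t).add_const (Real.cosh x))
      (twoShock_denom_pos t x).ne')
    refine h.congr_deriv ?_
    ring
  · have h := (((Real.hasDerivAt_sinh x).const_mul (-2)).div
      ((Real.hasDerivAt_cosh x).const_add (Real.exp (-t))) (twoShock_denom_pos t x).ne')
    refine h.congr_deriv ?_
    congr 1
    linear_combination (-2) * Real.cosh_sq x
  · have h := ((((((Real.hasDerivAt_cosh x).const_mul (Real.exp (-t))).add_const 1)).const_mul
      (-2)).div (((Real.hasDerivAt_cosh x).const_add (Real.exp (-t))).pow 2)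
      (pow_ne_zero 2 (twoShock_denom_pos t x).ne'))
    refine h.congr_deriv ?_
    have := (twoShock_denom_pos t x).ne'
    field_simp
    norm_num
    ring
  · exact ((continuous_const.mul cS).div cD cD0).continuousOn
  · exact (((continuous_const.mul cS).mul cE).div (cD.pow 2)
      fun p => pow_ne_zero 2 (cD0 p)).continuousOn
  · exact ((continuous_const.mul ((cE.mul cC).add continuous_const)).div (cD.pow 2)
      fun p => pow_ne_zero 2 (cD0 p)).continuousOn
  · exact ((continuous_const.mul (((cE.mul cS).mul cD).sub ((continuous_const.mul
      ((cE.mul cC).add continuous_const)).mul cS))).div (cD.pow 3)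
      fun p => pow_ne_zero 3 (cD0 p)).continuousOn
  · have := (twoShock_denom_pos t x).ne'
    unfold twoShock
    field_simp
    ring

lemma abs_sinh_le_cosh (x : ℝ) : |Real.sinh x| ≤ Real.cosh x := by
  rw [Real.abs_sinh, ← Real.cosh_abs]
  exact (Real.sinh_lt_cosh _).le

lemma tanh_add_tanh (a b : ℝ) :
    Real.tanh a + Real.tanh b =
      2 * Real.sinh (a + b) / (Real.cosh (a + b) + Real.cosh (a - b)) := by
  have ha := (Real.cosh_pos a).ne'
  have hb := (Real.cosh_pos b).ne'
  rw [Real.cosh_add, Real.cosh_sub, Real.sinh_add, Real.tanh_eq_sinh_div_cosh,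
    Real.tanh_eq_sinh_div_cosh,
    show Real.cosh a * Real.cosh b + Real.sinh a * Real.sinh b +
      (Real.cosh a * Real.cosh b - Real.sinh a * Real.sinh b) =
      2 * (Real.cosh a * Real.cosh b) by ring]
  field_simp

/-- The quotients `2 sinh x / (a + cosh x)` are Lipschitz in the parameter `a ≥ 0`. -/
lemma abs_two_sinh_div_sub_le {a b : ℝ} (ha : 0 ≤ a) (hb : 0 ≤ b) (x : ℝ) :
    |2 * Real.sinh x / (a + Real.cosh x) - 2 * Real.sinh x / (b + Real.cosh x)| ≤
      2 * |a - b| := by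
  have hc := Real.one_le_cosh x
  have h1 : 0 < a + Real.cosh x := by linarith
  have h2 : 0 < b + Real.cosh x := by linarith
  have e : 2 * Real.sinh x / (a + Real.cosh x) - 2 * Real.sinh x / (b + Real.cosh x) =
      2 * Real.sinh x * (b - a) / ((a + Real.cosh x) * (b + Real.cosh x)) := by
    field_simp
    ring
  rw [e, abs_div, abs_of_pos (mul_pos h1 h2), div_le_iff₀ (mul_pos h1 h2), abs_mul, abs_mul,
    abs_two, abs_sub_comm b]
  have h3 : |Real.sinh x| ≤ (a + Real.cosh x) * (b + Real.cosh x) := by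
    have := abs_sinh_le_cosh x
    nlinarith
  calc 2 * |Real.sinh x| * |a - b| = 2 * |a - b| * |Real.sinh x| := by ring
    _ ≤ _ := by gcongr

/-- The sum of the two shocks has the form of `-Ψ`'s quotient with parameter `cosh (log 2 - t) = exp
(-t) + exp t / 4`. The shift `log 2` makes the leading term match that of `twoShock`, leaving a
discrepancy `exp t / 4` that vanishes as `t → -∞`. -/
lemma shock_add_shock (t x : ℝ) :
    shock 2 0 (x - t + Real.log 2) + shock 0 (-2) (x + t - Real.log 2) =
      -(2 * Real.sinh x / (Real.exp (-t) + Real.exp t / 4 + Real.cosh x)) := by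
  have h := tanh_add_tanh ((x - t + Real.log 2) / 2) ((x + t - Real.log 2) / 2)
  have e1 : (x - t + Real.log 2) / 2 + (x + t - Real.log 2) / 2 = x := by ring
  have e2 : (x - t + Real.log 2) / 2 - (x + t - Real.log 2) / 2 = Real.log 2 - t := by ring
  have e3 : Real.cosh (Real.log 2 - t) = Real.exp (-t) + Real.exp t / 4 := by
    rw [Real.cosh_eq, neg_sub, Real.exp_sub, Real.exp_sub, Real.exp_log two_pos, Real.exp_neg]
    ring
  rw [e1, e2, e3, add_comm (Real.cosh x)] at h
  rw [← h]
  simp only [shock]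
  norm_num
  ring

lemma twoShock_tendstoUniformly_atBot :
    TendstoUniformly
      (fun t x => twoShock t x -
        (shock 2 0 (x - t + Real.log 2) + shock 0 (-2) (x + t - Real.log 2)))
      (fun _ => 0) atBot := by
  rw [Metric.tendstoUniformly_iff]
  intro ε hε
  filter_upwards [Real.tendsto_exp_atBot.eventually_lt_const hε] with t ht x
  rw [dist_comm, Real.dist_eq, sub_zero, shock_add_shock]
  have h := abs_two_sinh_div_sub_le (a := Real.exp (-t) + Real.exp t / 4) (b := Real.exp (-t))
    (by positivity) (by positivity) x
  rw [add_sub_cancel_left, abs_of_pos (show 0 < Real.exp t / 4 by positivity)] at h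
  have e : twoShock t x = -(2 * Real.sinh x / (Real.exp (-t) + Real.cosh x)) := by
    unfold twoShock; ring
  rw [e, sub_neg_eq_add, neg_add_eq_sub]
  linarith [Real.exp_pos t]

lemma twoShock_tendstoUniformly_atTop :
    TendstoUniformly twoShock (shock 2 (-2)) atTop := by
  rw [Metric.tendstoUniformly_iff]
  intro ε hε
  have h0 : Tendsto (fun t : ℝ => 2 * Real.exp (-t)) atTop (𝓝 0) := by
    simpa using (Real.tendsto_exp_neg_atTop_nhds_zero).const_mul 2
  filter_upwards [h0.eventually_lt_const hε] with t ht x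
  have h := abs_two_sinh_div_sub_le (a := Real.exp (-t)) (b := 0) (by positivity) le_rfl x
  rw [sub_zero, abs_of_pos (Real.exp_pos _)] at h
  have e : shock 2 (-2) x - twoShock t x =
      2 * Real.sinh x / (Real.exp (-t) + Real.cosh x) - 2 * Real.sinh x / (0 + Real.cosh x) := by
    rw [shock_neg_eq_profile]
    simp only [profile, twoShock, abs_zero]
    norm_num
    ring
  rw [Real.dist_eq, e]
  linarith

/-! ### The functions `Ψ_γ` are neither shocks nor constants. -/

lemma tendsto_tanh_atTop : Tendsto Real.tanh atTop (𝓝 1) := by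
  have h0 : Tendsto (fun x : ℝ => Real.exp (-x) / Real.cosh x) atTop (𝓝 0) :=
    squeeze_zero (fun x => div_nonneg (Real.exp_pos _).le (Real.cosh_pos _).le)
      (fun x => div_le_self (Real.exp_pos _).le (Real.one_le_cosh x))
      Real.tendsto_exp_neg_atTop_nhds_zero
  have h1 : Tendsto (fun x : ℝ => 1 - Real.exp (-x) / Real.cosh x) atTop (𝓝 (1 - 0)) :=
    h0.const_sub 1
  rw [sub_zero] at h1
  refine h1.congr fun x => ?_
  rw [Real.tanh_eq_sinh_div_cosh, ← Real.cosh_sub_sinh]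
  have := (Real.cosh_pos x).ne'
  field_simp
  ring

lemma tendsto_tanh_atBot : Tendsto Real.tanh atBot (𝓝 (-1)) := by
  refine ((tendsto_tanh_atTop.comp tendsto_neg_atBot_atTop).neg).congr fun x => ?_
  simp [Real.tanh_neg]

lemma tendsto_cosh_atTop : Tendsto Real.cosh atTop atTop := by
  refine tendsto_atTop_mono (fun x => ?_) (Real.tendsto_exp_atTop.atTop_div_const two_pos)
  rw [Real.cosh_eq]
  linarith [Real.exp_pos (-x)]

lemma psi_tendsto_atTop (γ : ℝ) : Tendsto (psi γ) atTop (𝓝 (-2)) := by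
  have h1 : Tendsto (fun x => γ / Real.cosh x + 1) atTop (𝓝 (0 + 1)) :=
    (tendsto_cosh_atTop.const_div_atTop γ).add_const 1
  have h2 := (tendsto_tanh_atTop.const_mul (-2)).div h1 (by norm_num)
  norm_num at h2
  refine h2.congr fun x => ?_
  have := (Real.cosh_pos x).ne'
  rw [psi, Pi.div_apply, Real.tanh_eq_sinh_div_cosh, div_add_one this, mul_div_assoc',
    neg_div', div_div_div_cancel_right₀ this, neg_mul]

lemma psi_neg (γ x : ℝ) : psi γ (-x) = -psi γ x := by
  simp only [psi, Real.sinh_neg, Real.cosh_neg]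
  ring

/-- The limits `∓2` at `±∞` exclude constants and force the end states `±2`; the zero at the origin
then fixes the translation, and the value at `1` contradicts `γ > 0`. -/
lemma psi_notMem_shocksAndConstants {γ : ℝ} (hγ : 0 < γ) : psi γ ∉ shocksAndConstants := by
  rintro ⟨β, α, y, hαβ, h⟩
  have top := psi_tendsto_atTop γ
  have bot : Tendsto (psi γ) atBot (𝓝 2) := by
    have := (top.comp tendsto_neg_atBot_atTop).neg
    rw [neg_neg] at this
    refine this.congr fun x => ?_
    simp [psi_neg]
  rw [h] at top bot
  rcases hαβ.eq_or_lt with rfl | hlt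
  · simp only [shock, sub_self, zero_div, zero_mul, sub_zero] at top bot
    have a1 := tendsto_nhds_unique top tendsto_const_nhds
    have a2 := tendsto_nhds_unique bot tendsto_const_nhds
    linarith
  · have hpos : 0 < (β - α) / 2 := by linarith
    have t1 : Tendsto (fun x : ℝ => (β - α) / 2 * (x - y) / 2) atTop atTop :=
      ((tendsto_atTop_add_const_right _ (-y) tendsto_id).const_mul_atTop hpos).atTop_div_const
        two_pos
    have t2 : Tendsto (fun x : ℝ => (β - α) / 2 * (x - y) / 2) atBot atBot :=
      ((tendsto_atBot_add_const_right _ (-y) tendsto_id).const_mul_atBot hpos).atBot_div_const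
        two_pos
    have b1 := tendsto_nhds_unique top
      (((tendsto_tanh_atTop.comp t1).const_mul ((β - α) / 2)).const_sub ((α + β) / 2))
    have b2 := tendsto_nhds_unique bot
      (((tendsto_tanh_atBot.comp t2).const_mul ((β - α) / 2)).const_sub ((α + β) / 2))
    obtain rfl : α = -2 := by linarith
    obtain rfl : β = 2 := by linarith
    have hy : y = 0 := by
      have := congrFun h 0
      rw [shock_neg_eq_profile] at this
      simp only [psi, profile] at this
      norm_num at this
      have hc := (Real.cosh_pos y).ne'
      rw [eq_comm, div_eq_zero_iff] at this
      simpa [hc] using this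
    have h1 := congrFun h 1
    rw [hy, shock_neg_eq_profile] at h1
    simp only [psi, profile] at h1
    norm_num at h1
    have hs : 0 < Real.sinh 1 := Real.sinh_pos_iff.2 one_pos
    have hc := Real.cosh_pos 1
    rw [div_eq_div_iff (by positivity) (by positivity)] at h1
    nlinarith [mul_pos hs hγ]

end Burgers

theorem proposition6p2 :
    ∃ u₀ : ℝ → ℝ, MemLp u₀ ⊤ volume ∧
      {v : ℝ → ℝ | ∃ γ : ℝ, 0 < γ ∧ v = Burgers.psi γ} ∪
          {v : ℝ → ℝ | ∃ δ ∈ Icc (0 : ℝ) 2, v = Burgers.shock δ (-δ)} ⊆ Burgers.omegaZero u₀ ∧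
      ¬ Burgers.omegaZero u₀ ⊆ Burgers.shocksAndConstants ∧
      -- the two-shock solution: an entire solution in the `ω`-limit set, never a shock or a
      -- constant, which describes the merger of two shocks into a single one
      Burgers.IsClassicalSolution univ Burgers.twoShock ∧
      (∀ t : ℝ, Burgers.twoShock t ∈ Burgers.omegaZero u₀ ∧
        Burgers.twoShock t ∉ Burgers.shocksAndConstants) ∧
      TendstoUniformly
        (fun t x => Burgers.twoShock t x -
          (Burgers.shock 2 0 (x - t + Real.log 2) + Burgers.shock 0 (-2) (x + t - Real.log 2)))
        (fun _ => 0) atBot ∧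
      TendstoUniformly Burgers.twoShock (Burgers.shock 2 (-2)) atTop := by
  obtain ⟨u₀, hu₀, h⟩ := Burgers.exists_profile_mem_omegaZero
  have hpsi : ∀ γ : ℝ, 0 < γ → Burgers.psi γ ∈ Burgers.omegaZero u₀ := fun γ hγ => by
    rw [Burgers.psi_eq_profile hγ.le]
    exact h (γ, 1) hγ.le zero_le_one le_rfl
  refine ⟨u₀, hu₀, ?_, fun hsub => Burgers.psi_notMem_shocksAndConstants one_pos
    (hsub (hpsi 1 one_pos)), Burgers.twoShock_isClassicalSolution,
    fun t => ⟨hpsi _ (Real.exp_pos (-t)),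
      Burgers.psi_notMem_shocksAndConstants (Real.exp_pos (-t))⟩,
    Burgers.twoShock_tendstoUniformly_atBot, Burgers.twoShock_tendstoUniformly_atTop⟩
  rintro v (⟨γ, hγ, rfl⟩ | ⟨δ, hδ, rfl⟩)
  · exact hpsi γ hγ
  · rw [Burgers.shock_neg_eq_profile]
    have h1 : δ / 2 ≤ 1 := by linarith [hδ.2]
    exact h (0, δ / 2) le_rfl (div_nonneg hδ.1 zero_le_two) h1
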